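/- Let $(D,\mathcal A,\mu)$ be a measure space, $\mathbb K\in\{\mathbb R,\mathbb C\}$, and let $F$ be a Hilbert space that is embedded into $L^2=L^2(D,\mathcal A,\mu)$ (with values in $\mathbb K$) by a compact injective linear map $T:F\to L^2$, $Tf=f$. Let $b_1,b_2,\dots$ be a (finite or infinite) orthogonal basis of $F$ with $N\in\mathbb N_0\cup\{\infty\}$ elements, normalized in $L^2$, consisting of eigenvectors of $T^*T$ for the nonincreasing eigenvalues $\lambda_1\ge\lambda_2\ge\dots$, where $\lambda_k=0$ for $k>N$, and put $\sigma(k)=\sqrt{\lambda_k}$ for $k\ge1$. *Algorithms and errors.* The functions whose values can be sampled form a linear space $V$ of measurable functions $D\to\mathbb K$ whose $\mu$-classes are exactly the elements of $F$ (if $F$ is a space of functions, $V=F$; if $F$ consists of classes, $V$ may be the space of all measurable representatives). A randomized algorithm with at most $n$ function values is a family $(A^\omega)_{\omega\in\Omega}$ of maps $V\to L^2$, on a probability space $(\Omega,\mathcal F,\mathbb P)$, such that for each $\omega$ the value $A^\omega(g)$ is computed from at most $n$ adaptively chosen function values of $g$. It is called measurable if $(g,\omega)\mapsto A^\omega(g)$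 is jointly measurable (with respect to the Borel $\sigma$-algebra of $L^2$) for $g$ in each finite-dimensional subspace of $V$. Its error is $$e^{\rm ran}(A)=\sup\big(\mathbb E_\omega\|g-A^\omega(g)\|_2^2\big)^{1/2},$$ the supremum being over all $g\in V$ that represent an element of the closed unit ball of $F$; $e^{\rm ran}(n,T,\Lambda^{\rm std})$ is the infimum of $e^{\rm ran}(A)$ over all measurable randomized algorithms $A$ with at most $n$ function values. *The algorithm $A_n^r$.* For $1\le m\le N$ let $u_m=\frac1m\sum_{j=1}^m|b_j|^2$ and let $\mu_m$ be the probability measure with density $u_m$ with respect to $\mu$. For $r\ge0$ let $\ell_r=\lceil 2r+1\rceil$, let $n_j=m_j=0$ for $j\le\ell_r$, and let $n_j=2^{j-1}$, $m_j=\min\{2^{j-1-\ell_r},N\}$ for $j>\ell_r$. Let $X_i^{(j)}$ ($j\ge1$, $1\le i\le n_j$) be independent random variables such that $X_i^{(j)}$ has distribution $\mu_{m_j}$. Put $M^{(0)}g=0$ and, for $k\ge1$, $$M^{(k)}g=M^{(k-1)}g+\sum_{j=1}^{m_k}\Big[\frac1{n_k}\sum_{i=1}^{n_k}\frac{(g-M^{(k-1)}g)\,\overline{b_j}}{u_{m_k}}\big(X_i^{(k)}\big)\Big]b_j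 ,$$ where the quotient is read as $0$ at points where $u_{m_k}=0$. For $n\in\mathbb N=\{1,2,\dots\}$ set $A_n^r=M^{(k)}$, where $2^k\le n<2^{k+1}$. **Corollary.** Let $r\ge0$ be such that $\sigma(2n)\ge2^{-r}\sigma(n)$ for all $n\in\mathbb N$, and let $\tilde c_r=2^{\,r\lceil 2r+4\rceil+3/2}$. Then, for every $n\in\mathbb N$, $A_n^r$ is a measurable randomized algorithm with at most $n$ function values, and $$e^{\rm ran}(A_n^r)\le\tilde c_r\; e^{\rm ran}(n,T,\Lambda^{\rm std}).$$ Thus $A_n^r$ is optimal up to a constant that depends only on $r$, uniformly in $n$. -/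

import Mathlib

open MeasureTheory ProbabilityTheory Finset
open scoped ENNReal

universe uD uK uF uΩ uΩ'

namespace MCApprox

/-- A deterministic adaptive algorithm that asks for at most `n` values of an unknown function
`D → 𝕜` and returns an element of `G`. It either stops with an output, or asks for the value of
the function at a point and continues, depending on the answer, with at most one value less. -/
inductive SamplingTree (D : Type*) (𝕜 : Type*) (G : Type*) : ℕ → Type _
  | output {n : ℕ} (y : G) : SamplingTree D 𝕜 G n
  | sample {n : ℕ} (x : D) (next : 𝕜 → SamplingTree D 𝕜 G n) : SamplingTree D 𝕜 G (n + 1)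

/-- The result of the deterministic algorithm for the input function `g`. -/
def SamplingTree.eval {D : Type*} {𝕜 : Type*} {G : Type*} :
    {n : ℕ} → SamplingTree D 𝕜 G n → (D → 𝕜) → G
  | _, .output y, _ => y
  | _, .sample x next, g => (next (g x)).eval g

section Setting

variable {D : Type uD} [MeasurableSpace D] {𝕜 : Type uK} [RCLike 𝕜] {μ : Measure D}
  {F : Type uF} [NormedAddCommGroup F] [InnerProductSpace 𝕜 F]

/-- `V` is a linear space of measurable functions on `D` whose equivalence classes are exactly the
elements of the space `F`, embedded into `L²` by `T`. The elements of `V` are the functions whose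
values can be sampled. If `F` is a space of functions defined everywhere, then `V` is `F` itself;
if `F` consists of classes, then `V` may be the space of all their measurable representatives. -/
structure IsFunctionSpace (T : F →L[𝕜] Lp 𝕜 2 μ) (V : Submodule 𝕜 (D → 𝕜)) : Prop where
  measurable : ∀ g ∈ V, Measurable g
  exists_class : ∀ g ∈ V, ∃ f : F, g =ᵐ[μ] T f
  exists_function : ∀ f : F, ∃ g ∈ V, g =ᵐ[μ] T f

/-- `A` is a measurable randomized algorithm on `V` that uses at most `n` function values:
for each `ω` it is a deterministic adaptive algorithm with at most `n` function values, and
`(g, ω) ↦ A ω g` is jointly measurable for `g` in each finite-dimensional subspace of `V`.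
If `F` is a space of functions and `V = F`, then the latter holds in particular whenever
`(f, ω) ↦ A ω f` is measurable on `F × Ω`. -/
structure IsStdAlgorithm {Ω : Type uΩ} [MeasurableSpace Ω] (V : Submodule 𝕜 (D → 𝕜)) (n : ℕ)
    (A : Ω → (D → 𝕜) → Lp 𝕜 2 μ) : Prop where
  samples : ∀ ω, ∃ t : SamplingTree D 𝕜 (Lp 𝕜 2 μ) n, ∀ g ∈ V, A ω g = t.eval g
  measurable : ∀ (d : ℕ) (v : Fin d → D → 𝕜), (∀ i, v i ∈ V) →
    Measurable[inferInstance, borel (Lp 𝕜 2 μ)]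
      (fun p : (Fin d → 𝕜) × Ω => A p.2 (∑ i, p.1 i • v i))

/-- The worst case error `sup_f (𝔼 ‖f - A(f)‖₂²)^(1/2)` over the unit ball of `F`. -/
noncomputable def randError (T : F →L[𝕜] Lp 𝕜 2 μ) (V : Submodule 𝕜 (D → 𝕜))
    {Ω : Type uΩ} [MeasurableSpace Ω] (P : Measure Ω) (A : Ω → (D → 𝕜) → Lp 𝕜 2 μ) : ℝ≥0∞ :=
  ⨆ (f : F) (_ : ‖f‖ ≤ 1) (g : D → 𝕜) (_ : g ∈ V) (_ : g =ᵐ[μ] T f),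
    (∫⁻ ω, ‖T f - A ω g‖ₑ ^ 2 ∂P) ^ (1 / 2 : ℝ)

/-- The minimal worst case error `e^ran(n, T, Λ^std)` among all measurable randomized algorithms,
on any probability space, that use at most `n` function values. -/
noncomputable def minRandError (T : F →L[𝕜] Lp 𝕜 2 μ) (V : Submodule 𝕜 (D → 𝕜)) (n : ℕ) : ℝ≥0∞ :=
  ⨅ (Ω : Type uΩ) (_ : MeasurableSpace Ω) (P : Measure Ω) (_ : IsProbabilityMeasure P)
    (A : Ω → (D → 𝕜) → Lp 𝕜 2 μ) (_ : IsStdAlgorithm V n A), randError T V P A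

/-- A singular value decomposition of `T`: an orthogonal basis `b 1, b 2, …` of `F` with `N`
elements, normalized in `L²`, which consists of eigenvectors of `T* T` for the nonincreasing
eigenvalues `eig 1, eig 2, …`; the sequence of eigenvalues is continued by zero beyond `N`.
Only the `b k` with `1 ≤ k ≤ N` and the `eig k` with `1 ≤ k` have a meaning. -/
structure SVD [CompleteSpace F] (T : F →L[𝕜] Lp 𝕜 2 μ) where
  N : ℕ∞
  b : ℕ → F
  eig : ℕ → ℝ
  orthogonal : ∀ j k : ℕ, 1 ≤ j → (j : ℕ∞) ≤ N → 1 ≤ k → (k : ℕ∞) ≤ N → j ≠ k →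
    inner 𝕜 (b j) (b k) = 0
  dense_span : (Submodule.span 𝕜 {f | ∃ k : ℕ, 1 ≤ k ∧ (k : ℕ∞) ≤ N ∧ f = b k}).topologicalClosure
    = ⊤
  normalized : ∀ k : ℕ, 1 ≤ k → (k : ℕ∞) ≤ N → ‖T (b k)‖ = 1
  eigenvector : ∀ k : ℕ, 1 ≤ k → (k : ℕ∞) ≤ N →
    ContinuousLinearMap.adjoint T (T (b k)) = (eig k : 𝕜) • b k
  antitone : ∀ j k : ℕ, 1 ≤ j → j ≤ k → eig k ≤ eig j
  eig_eq_zero : ∀ k : ℕ, N < (k : ℕ∞) → eig k = 0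

namespace SVD

variable [CompleteSpace F] {T : F →L[𝕜] Lp 𝕜 2 μ} (S : SVD T)

/-- The singular values `σ(n)`, for `n ≥ 1`. -/
noncomputable def sigma (n : ℕ) : ℝ := Real.sqrt (S.eig n)

/-- A fixed representative of `b j` as a function on `D`. -/
noncomputable def fn (j : ℕ) : D → 𝕜 := T (S.b j)

/-- The density `u_m = (1/m) ∑_{j ≤ m} |b_j|²`. -/
noncomputable def density (m : ℕ) (x : D) : ℝ := (1 / (m : ℝ)) * ∑ j ∈ Icc 1 m, ‖S.fn j x‖ ^ 2

/-- The probability measure `μ_m` with density `u_m` with respect to `μ`. -/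
noncomputable def sampleMeasure (m : ℕ) : Measure D :=
  μ.withDensity fun x => ENNReal.ofReal (S.density m x)

/-- The result of `M^{(k)}_{n,m}` for the input `g` if the nodes are `x j i`, that is,
`M^{(0)} g = 0` and `M^{(k)} g = M^{(k-1)} g +
∑_{j ≤ m_k} [(1/n_k) ∑_{i ≤ n_k} ((g - M^{(k-1)} g) conj(b_j) / u_{m_k}) (x k i)] b_j`. -/
noncomputable def method (n m : ℕ → ℕ) (x : (j : ℕ) → Fin (n j) → D) :
    ℕ → (D → 𝕜) → D → 𝕜
  | 0, _ => 0
  | k + 1, g => fun y => method n m x k g y + ∑ j ∈ Icc 1 (m (k + 1)),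
      ((1 / (n (k + 1) : 𝕜)) * ∑ i : Fin (n (k + 1)),
        (g (x (k + 1) i) - method n m x k g (x (k + 1) i)) *
          (starRingEnd 𝕜) (S.fn j (x (k + 1) i)) /
            ((S.density (m (k + 1)) (x (k + 1) i) : ℝ) : 𝕜)) * S.fn j y

theorem memLp_method (n m : ℕ → ℕ) (x : (j : ℕ) → Fin (n j) → D) (k : ℕ) (g : D → 𝕜) :
    MemLp (S.method n m x k g) 2 μ := by
  induction k with
  | zero => exact MemLp.zero
  | succ k ih => exact ih.add (memLp_finsetSum _ fun j _ => (Lp.memLp (T (S.b j))).const_mul _)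

/-- The random nodes used by the methods `M^{(k)}_{n,m}`: `X j i` has the distribution `μ_{m_j}`
for `i = 1, …, n_j`, and all these random variables are independent. -/
structure IsNodes {Ω : Type uΩ} [MeasurableSpace Ω] (P : Measure Ω) (n m : ℕ → ℕ)
    (X : (j : ℕ) → Fin (n j) → Ω → D) : Prop where
  measurable : ∀ j i, Measurable (X j i)
  law : ∀ j i, P.map (X j i) = S.sampleMeasure (m j)
  indep : iIndepFun (fun p : (j : ℕ) × Fin (n j) => X p.1 p.2) P

/-- `ℓ_r = ⌈2r + 1⌉`. -/
noncomputable def ell (r : ℝ) : ℕ := ⌈2 * r + 1⌉₊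

/-- The numbers `n_j` of nodes of the algorithm `A_n^r`. -/
noncomputable def nodeCount (r : ℝ) (j : ℕ) : ℕ := if j ≤ ell r then 0 else 2 ^ (j - 1)

/-- The numbers `m_j` of approximated coefficients of the algorithm `A_n^r`. -/
noncomputable def coeffCount (r : ℝ) (j : ℕ) : ℕ :=
  if j ≤ ell r then 0 else (min ((2 ^ (j - 1 - ell r) : ℕ) : ℕ∞) S.N).toNat

/-- The algorithm `A_n^r = M^{(k)}_{n,m}` with `2^k ≤ n < 2^{k+1}`, for the random nodes `X`. -/
noncomputable def algorithm (r : ℝ) {Ω : Type uΩ} (X : (j : ℕ) → Fin (nodeCount r j) → Ω → D)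
    (n : ℕ) (ω : Ω) (g : D → 𝕜) : Lp 𝕜 2 μ :=
  (S.memLp_method (nodeCount r) (S.coeffCount r) (fun j i => X j i ω) (Nat.log 2 n) g).toLp

end SVD

end Setting

end MCApprox

/-!
The minimal error and the error of the algorithm `A_n^r` are compared through the singular values.

*Lower bound* (`sigma_div_two_le_minRandError`): every randomized algorithm with `n` function values
has an error of at least `σ(2n) / 2`. Consider the functions `σ(2n) ∑ c_i b_i` with `i ≤ 2n`, which
lie in the unit ball of `F` for `|c| ≤ 1`. By Tonelli's theorem it is enough to bound the average
over `c` of the squared error of a deterministic adaptive algorithm. If the distribution of `c` has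
a rotation invariant density, then each function value reveals, after a rotation, just one
coordinate of `c`, and given this coordinate, the distribution of the other ones is again rotation invariant.
By induction, `n` function values reveal at most half of the mean square of `c ∈ 𝕜^(2n)`
(`lintegral_adaptive_ge`). The uniform distribution on the shell `1/2 ≤ |c|² ≤ 1` gives the bound.

*Upper bound* (`SVD.lintegral_approx_succ_le`): in the step from `M^{(k-1)}` to `M^{(k)}`, the first
`m_k` coefficients of the residual are estimated without bias by a mean over `n_k` nodes that are
independent of the residual. With the density `u_{m_k}`, the variances add up to at most `m_k / n_k`
times the squared norm of the residual, and the coefficients that are not estimated contribute at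
most `σ(m_k + 1)²`. For the chosen `n_k` and `m_k` one has `m_k / n_k = 2^(-ℓ_r)`, and since the
singular values satisfy `σ(2n) ≥ 2^(-r) σ(n)`, it follows by induction that the mean square error is
at most `2 σ(2^(k-1-ℓ_r))²` (`SVD.lintegral_algorithm_le`). The same condition on the singular
values compares this with `σ(2n)²`, where `n < 2^(k+1)` (`SVD.randError_algorithm_le`). It also
excludes that the number of singular values is finite and positive.
-/

namespace MCApprox

-- The search for a measurable structure on `𝕜` from `RCLike 𝕜` takes many steps.
set_option synthInstance.maxHeartbeats 200000

/-! ### Rotation invariant distributions and adaptive algorithms -/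

section SphericalAverage

variable {𝕜 : Type*} [RCLike 𝕜]

/-- The square of the Euclidean norm of a vector. -/
noncomputable def sqNorm {d : ℕ} (c : Fin d → 𝕜) : ℝ≥0∞ := ∑ i, ‖c i‖ₑ ^ 2

theorem measurable_sqNorm {d : ℕ} : Measurable (sqNorm : (Fin d → 𝕜) → ℝ≥0∞) := by
  unfold sqNorm
  fun_prop

theorem sqNorm_neg {d : ℕ} (c : Fin d → 𝕜) : sqNorm (-c) = sqNorm c := by
  simp [sqNorm]

theorem sqNorm_cons {d : ℕ} (y : 𝕜) (c : Fin d → 𝕜) :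
    sqNorm (Fin.cons y c : Fin (d + 1) → 𝕜) = ‖y‖ₑ ^ 2 + sqNorm c := by
  simp [sqNorm, Fin.sum_univ_succ]

theorem sqNorm_sub_tail_le {d : ℕ} (y : 𝕜) (c : Fin d → 𝕜) (u : Fin (d + 1) → 𝕜) :
    sqNorm (c - Fin.tail u) ≤ sqNorm (Fin.cons y c - u) := by
  rw [sqNorm, sqNorm, Fin.sum_univ_succ]
  exact le_add_self

theorem enorm_sq_eq_ofReal {E : Type*} [SeminormedAddCommGroup E] (x : E) :
    ‖x‖ₑ ^ 2 = ENNReal.ofReal (‖x‖ ^ 2) := by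
  rw [← ofReal_norm, ENNReal.ofReal_pow (norm_nonneg _)]

theorem sqNorm_eq_ofReal {d : ℕ} (c : Fin d → 𝕜) :
    sqNorm c = ENNReal.ofReal (∑ i, ‖c i‖ ^ 2) := by
  rw [sqNorm, ENNReal.ofReal_sum_of_nonneg fun i _ => by positivity]
  simp_rw [enorm_sq_eq_ofReal]

theorem sqNorm_ofLp {d : ℕ} (c : EuclideanSpace 𝕜 (Fin d)) :
    sqNorm c.ofLp = ENNReal.ofReal (‖c‖ ^ 2) := by
  rw [sqNorm_eq_ofReal, EuclideanSpace.norm_sq_eq]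

theorem two_mul_sqNorm_le {d : ℕ} (c y : Fin d → 𝕜) :
    2 * sqNorm c ≤ sqNorm (c - y) + sqNorm (-c - y) := by
  simp only [sqNorm, mul_sum, ← sum_add_distrib]
  refine sum_le_sum fun i _ => ?_
  simp only [enorm_sq_eq_ofReal, Pi.sub_apply, Pi.neg_apply]
  rw [← ENNReal.ofReal_add (by positivity) (by positivity),
    show (2 : ℝ≥0∞) = ENNReal.ofReal 2 by simp, ← ENNReal.ofReal_mul (by positivity)]
  refine ENNReal.ofReal_le_ofReal ?_
  have h1 : ‖-c i - y i‖ = ‖c i + y i‖ := by rw [← norm_neg]; congr 1; ring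
  have h2 := parallelogram_law_with_norm 𝕜 (c i) (y i)
  rw [h1]
  nlinarith [sq_nonneg ‖y i‖]

/-- A linear functional is, up to an isometric change of coordinates, a multiple of the first
coordinate. -/
theorem exists_isometry_functional {d : ℕ} (l : (Fin (d + 1) → 𝕜) →ₗ[𝕜] 𝕜) :
    ∃ U : (Fin (d + 1) → 𝕜) ≃ₗ[𝕜] (Fin (d + 1) → 𝕜),
      (∀ c, sqNorm (U c) = sqNorm c) ∧ ∃ α : 𝕜, ∀ c, l (U c) = α * c 0 := by
  -- The functional is `⟪a, ·⟫`; take an orthonormal basis whose first vector is parallel to `a`.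
  let E := EuclideanSpace 𝕜 (Fin (d + 1))
  let l' : E →L[𝕜] 𝕜 :=
    LinearMap.toContinuousLinearMap (l ∘ₗ (WithLp.linearEquiv 2 𝕜 (Fin (d + 1) → 𝕜)).toLinearMap)
  obtain ⟨a, ha⟩ : ∃ a : E, ∀ c, l' c = inner 𝕜 a c :=
    ⟨(InnerProductSpace.toDual 𝕜 E).symm l', fun c =>
      (InnerProductSpace.toDual_symm_apply).symm⟩
  obtain ⟨e, he, α, hα⟩ : ∃ e : E, ‖e‖ = 1 ∧ ∃ α : 𝕜, a = α • e := by
    by_cases h : a = 0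
    · exact ⟨EuclideanSpace.single 0 1, by rw [PiLp.norm_single, norm_one], 0,
        by rw [h, zero_smul]⟩
    · refine ⟨((‖a‖ : 𝕜)⁻¹) • a, norm_smul_inv_norm h, (‖a‖ : 𝕜), ?_⟩
      rw [smul_smul, mul_inv_cancel₀ (RCLike.ofReal_ne_zero.2 (norm_ne_zero_iff.2 h)),
        one_smul]
  obtain ⟨b, hb⟩ := Orthonormal.exists_orthonormalBasis_extension_of_card_eq
    (𝕜 := 𝕜) (E := E) (ι := Fin (d + 1)) (by simp [E]) (v := fun _ => e) (s := {0})
    (by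
      rw [orthonormal_iff_ite]
      rintro ⟨i, rfl⟩ ⟨j, rfl⟩
      simp [inner_self_eq_norm_sq_to_K, he])
  have hb0 : b 0 = e := hb 0 rfl
  refine ⟨(WithLp.linearEquiv 2 𝕜 (Fin (d + 1) → 𝕜)).symm ≪≫ₗ b.repr.symm.toLinearEquiv ≪≫ₗ
    (WithLp.linearEquiv 2 𝕜 (Fin (d + 1) → 𝕜)), fun c => ?_, starRingEnd 𝕜 α, fun c => ?_⟩
  · have h1 := sqNorm_ofLp (b.repr.symm (WithLp.toLp 2 c))
    rw [LinearIsometryEquiv.norm_map, ← sqNorm_ofLp] at h1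
    exact h1
  · have h1 : l' (b.repr.symm (WithLp.toLp 2 c)) = starRingEnd 𝕜 α * c 0 := by
      rw [ha, hα, inner_smul_left, ← hb0, ← b.repr_apply_apply]
      simp
    exact h1

/-- A linear map that preserves the Euclidean norm preserves the product Haar measure: it rescales
the measure, and it maps the unit ball onto itself. -/
theorem measurePreserving_of_sqNorm {d : ℕ} (ν : Measure 𝕜) [ν.IsAddHaarMeasure]
    (U : (Fin d → 𝕜) ≃ₗ[𝕜] (Fin d → 𝕜)) (hU : ∀ c, sqNorm (U c) = sqNorm c) :
    MeasurePreserving U (Measure.pi fun _ => ν) (Measure.pi fun _ => ν) := by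
  set π : Measure (Fin d → 𝕜) := Measure.pi fun _ => ν
  let U' : (Fin d → 𝕜) ≃L[𝕜] (Fin d → 𝕜) := U.toContinuousLinearEquiv
  have hm : Measurable U := U'.continuous.measurable
  have : (π.map U).IsAddHaarMeasure := U'.isAddHaarMeasure_map π
  refine ⟨hm, ?_⟩
  have hB : Continuous fun c : Fin d → 𝕜 => ∑ i, ‖c i‖ ^ 2 := by fun_prop
  let B : Set (Fin d → 𝕜) := {c | ∑ i, ‖c i‖ ^ 2 < 1}
  have hBo : IsOpen B := isOpen_lt hB continuous_const
  have h0 : π B ≠ 0 := (hBo.measure_pos π ⟨0, by simp [B]⟩).ne'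
  have h1 : π B ≠ ∞ := by
    refine ((measure_mono ?_).trans_lt (measure_closedBall_lt_top (μ := π) (x := 0) (r := 1))).ne
    intro c hc
    rw [mem_closedBall_zero_iff, pi_norm_le_iff_of_nonneg zero_le_one]
    intro i
    have h2 := single_le_sum (f := fun i => ‖c i‖ ^ 2) (fun i _ => by positivity) (mem_univ i)
    have h3 : ‖c i‖ ^ 2 ≤ 1 := h2.trans (le_of_lt hc)
    exact (sq_le_one_iff₀ (norm_nonneg _)).1 h3
  have hpre : U ⁻¹' B = B := by
    ext c
    have h := hU c
    rw [sqNorm_eq_ofReal, sqNorm_eq_ofReal, ENNReal.ofReal_eq_ofReal_iff (by positivity)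
      (by positivity)] at h
    simp [B, h]
  have h2 := Measure.isAddLeftInvariant_eq_smul (π.map U) π
  have h3 : (π.map U) B = π B := by rw [Measure.map_apply hm hBo.measurableSet, hpre]
  rw [h2, Measure.smul_apply, ENNReal.smul_def, smul_eq_mul] at h3
  have h4 : ((Measure.addHaarScalarFactor (π.map U) π : NNReal) : ℝ≥0∞) = 1 := by
    rwa [ENNReal.mul_eq_right h0 h1] at h3
  rw [h2, ENNReal.coe_eq_one.1 h4, one_smul]

theorem lintegral_cons {d : ℕ} (ν : Measure 𝕜) [ν.IsAddHaarMeasure]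
    {f : (Fin (d + 1) → 𝕜) → ℝ≥0∞} (hf : Measurable f) :
    ∫⁻ c, f c ∂(Measure.pi fun _ => ν) =
      ∫⁻ y, ∫⁻ c, f (Fin.cons y c) ∂(Measure.pi fun _ : Fin d => ν) ∂ν := by
  have h := (measurePreserving_piFinSuccAbove (fun _ : Fin (d + 1) => ν) 0).symm
  rw [← h.lintegral_comp hf]
  refine (lintegral_prod (μ := ν) (ν := Measure.pi fun _ : Fin d => ν) _
    (hf.comp h.measurable).aemeasurable).trans ?_
  simp [MeasurableEquiv.piFinSuccAbove, Fin.consEquiv]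

/-- All coordinates contribute equally to the integral of a radial function. -/
theorem lintegral_coord_eq {d : ℕ} (ν : Measure 𝕜) [ν.IsAddHaarMeasure] {w : ℝ≥0∞ → ℝ≥0∞}
    (hw : Measurable w) (i j : Fin d) :
    ∫⁻ c : Fin d → 𝕜, ‖c i‖ₑ ^ 2 * w (sqNorm c) ∂(Measure.pi fun _ => ν) =
      ∫⁻ c : Fin d → 𝕜, ‖c j‖ₑ ^ 2 * w (sqNorm c) ∂(Measure.pi fun _ => ν) := by
  let U : (Fin d → 𝕜) ≃ₗ[𝕜] (Fin d → 𝕜) := LinearEquiv.funCongrLeft 𝕜 𝕜 (Equiv.swap i j)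
  have hU : ∀ c, sqNorm (U c) = sqNorm c := fun c =>
    Equiv.sum_comp (Equiv.swap i j) fun k => ‖c k‖ₑ ^ 2
  have hs := measurable_sqNorm (𝕜 := 𝕜) (d := d)
  rw [← (measurePreserving_of_sqNorm ν U hU).lintegral_comp (by fun_prop)]
  simp only [hU]
  simp [U, LinearEquiv.funCongrLeft, LinearMap.funLeft]

theorem lintegral_sqNorm_eq {d : ℕ} (ν : Measure 𝕜) [ν.IsAddHaarMeasure] {w : ℝ≥0∞ → ℝ≥0∞}
    (hw : Measurable w) (i : Fin d) :
    ∫⁻ c : Fin d → 𝕜, sqNorm c * w (sqNorm c) ∂(Measure.pi fun _ => ν) =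
      d * ∫⁻ c : Fin d → 𝕜, ‖c i‖ₑ ^ 2 * w (sqNorm c) ∂(Measure.pi fun _ => ν) := by
  have hs := measurable_sqNorm (𝕜 := 𝕜) (d := d)
  conv_lhs => enter [2, c]; rw [sqNorm, sum_mul]
  change ∫⁻ c : Fin d → 𝕜, ∑ k, ‖c k‖ₑ ^ 2 * w (sqNorm c) ∂_ = _
  rw [lintegral_finsetSum _ fun k _ => by fun_prop,
    sum_congr rfl fun k _ => lintegral_coord_eq ν hw k i]
  simp

/-- An adaptive algorithm that asks for `n` linear functionals of a vector `c ∈ 𝕜^d` with a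
rotation invariant distribution cannot recover more than the share `n / d` of the mean square of
`c`. The proof is by induction on `n`: after a rotation the first question is for the first
coordinate, and given the answer, the remaining coordinates have again a rotation invariant
distribution. In this way, no measurability of the algorithm in the course of its computation
is needed. -/
theorem lintegral_adaptive_ge {X G : Type*} (ν : Measure 𝕜) [ν.IsAddHaarMeasure] {n : ℕ}
    (t : SamplingTree X 𝕜 G n) : ∀ {d : ℕ} (a : X → 𝕜) (L : (Fin d → 𝕜) →ₗ[𝕜] (X → 𝕜))
    (out : G → Fin d → 𝕜) {w : ℝ≥0∞ → ℝ≥0∞}, Measurable w →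
    Measurable (fun c => out (t.eval (a + L c))) →
    ((d - n : ℕ) : ℝ≥0∞) * ∫⁻ c : Fin d → 𝕜, sqNorm c * w (sqNorm c) ∂(Measure.pi fun _ => ν) ≤
      d * ∫⁻ c : Fin d → 𝕜, sqNorm (c - out (t.eval (a + L c))) * w (sqNorm c)
        ∂(Measure.pi fun _ => ν) := by
  induction t with
  | @output n y =>
    intro d a L out w hw _
    have hs := measurable_sqNorm (𝕜 := 𝕜) (d := d)
    simp only [SamplingTree.eval]
    set π : Measure (Fin d → 𝕜) := Measure.pi fun _ => ν
    have hneg : MeasurePreserving (fun c : Fin d → 𝕜 => -c) π π :=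
      measurePreserving_of_sqNorm ν (LinearEquiv.neg 𝕜) sqNorm_neg
    refine mul_le_mul (by exact_mod_cast Nat.sub_le d n) ?_ zero_le zero_le
    have h2 : (2 : ℝ≥0∞) * ∫⁻ c, sqNorm c * w (sqNorm c) ∂π ≤
        2 * ∫⁻ c, sqNorm (c - out y) * w (sqNorm c) ∂π := by
      calc (2 : ℝ≥0∞) * ∫⁻ c, sqNorm c * w (sqNorm c) ∂π
          = ∫⁻ c, 2 * sqNorm c * w (sqNorm c) ∂π := by
            simp_rw [mul_assoc]
            rw [lintegral_const_mul _ (by fun_prop)]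
        _ ≤ ∫⁻ c, sqNorm (c - out y) * w (sqNorm c) + sqNorm (-c - out y) * w (sqNorm (-c)) ∂π := by
            refine lintegral_mono fun c => ?_
            rw [sqNorm_neg, ← add_mul]
            exact mul_le_mul_left (two_mul_sqNorm_le c (out y)) _
        _ = _ := by
            rw [lintegral_add_left (by fun_prop), hneg.lintegral_comp
              (f := fun c => sqNorm (c - out y) * w (sqNorm c)) (by fun_prop), two_mul]
    exact (ENNReal.mul_le_mul_iff_right two_ne_zero ENNReal.ofNat_ne_top).1 h2
  | @sample n x next ih =>
    intro d a L out w hw hm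
    obtain _ | _ | d := d
    · simp
    · simp
    have hs := measurable_sqNorm (𝕜 := 𝕜) (d := d + 1)
    have hs' := measurable_sqNorm (𝕜 := 𝕜) (d := d + 1 + 1)
    simp only [SamplingTree.eval] at hm ⊢
    obtain ⟨U, hU, α, hα⟩ := exists_isometry_functional (LinearMap.proj x ∘ₗ L)
    have hUm := measurePreserving_of_sqNorm ν U hU
    set φ : (Fin (d + 1 + 1) → 𝕜) → (Fin (d + 1 + 1) → 𝕜) :=
      fun c => out ((next ((a + L c) x)).eval (a + L c)) with hφ
    set π : Measure (Fin (d + 1 + 1) → 𝕜) := Measure.pi fun _ => ν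
    set π' : Measure (Fin (d + 1) → 𝕜) := Measure.pi fun _ => ν
    have hUsymm : ∀ c, sqNorm (U.symm c) = sqNorm c := fun c => by
      rw [← hU, LinearEquiv.apply_symm_apply]
    have hUsm : Measurable U.symm := (measurePreserving_of_sqNorm ν U.symm hUsymm).measurable
    have hUm' := hUm.measurable
    have hcons : ∀ y : 𝕜,
        Measurable fun c : Fin (d + 1) → 𝕜 => (Fin.cons y c : Fin (d + 1 + 1) → 𝕜) := by
      intro y
      rw [measurable_pi_iff]
      intro i
      refine Fin.cases ?_ (fun i => ?_) i
      · simp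
      · simpa using measurable_pi_apply i
    have htail : Measurable (Fin.tail : (Fin (d + 1 + 1) → 𝕜) → (Fin (d + 1) → 𝕜)) := by
      rw [measurable_pi_iff]
      exact fun i => measurable_pi_apply _
    let L' : (Fin (d + 1) → 𝕜) →ₗ[𝕜] (X → 𝕜) := L ∘ₗ U.toLinearMap ∘ₗ
      { toFun := fun c => Fin.cons 0 c
        map_add' := fun c c' => by ext i; refine Fin.cases ?_ (fun i => ?_) i <;> simp
        map_smul' := fun s c => by ext i; refine Fin.cases ?_ (fun i => ?_) i <;> simp }
    have hL' : ∀ (y : 𝕜) (c : Fin (d + 1) → 𝕜),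
        a + L (U (Fin.cons y c)) = (a + L (U (Fin.cons y 0))) + L' c := by
      intro y c
      have h1 : (Fin.cons y c : Fin (d + 1 + 1) → 𝕜) = Fin.cons y 0 + Fin.cons 0 c := by
        ext i; refine Fin.cases ?_ (fun i => ?_) i <;> simp
      rw [h1, map_add, LinearMap.map_add, ← add_assoc]
      rfl
    have hans : ∀ (y : 𝕜) (c : Fin (d + 1) → 𝕜),
        (a + L (U (Fin.cons y c))) x = a x + α * y := by
      intro y c
      have h1 := hα (Fin.cons y c)
      simp only [LinearMap.comp_apply, LinearMap.proj_apply, Fin.cons_zero] at h1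
      rw [Pi.add_apply, h1]
    -- The induction hypothesis for the remaining coordinates if the first coordinate is `y`.
    have key : ∀ y : 𝕜, ((d + 1 - n : ℕ) : ℝ≥0∞) *
        ∫⁻ c, sqNorm c * w (‖y‖ₑ ^ 2 + sqNorm c) ∂π' ≤ ((d + 1 : ℕ) : ℝ≥0∞) *
        ∫⁻ c, sqNorm (Fin.cons y c - U.symm (φ (U (Fin.cons y c)))) *
          w (sqNorm (Fin.cons y c : Fin (d + 1 + 1) → 𝕜)) ∂π' := by
      intro y
      have heq : ∀ c, out ((next (a x + α * y)).eval ((a + L (U (Fin.cons y 0))) + L' c)) =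
          φ (U (Fin.cons y c)) := fun c => by rw [← hL', hφ]; simp only [hans]
      have h1 := ih (a x + α * y) (a + L (U (Fin.cons y 0))) L' (fun g => Fin.tail (U.symm (out g)))
        (w := fun s => w (‖y‖ₑ ^ 2 + s)) (by fun_prop) (by
          simp only [heq]
          exact htail.comp (hUsm.comp (hm.comp (hUm'.comp (hcons y)))))
      refine h1.trans (mul_le_mul_right (lintegral_mono fun c => ?_) _)
      simp only [heq, sqNorm_cons]
      exact mul_le_mul_left (sqNorm_sub_tail_le y c _) _
    -- Integration over the first coordinate.
    have hint : ((d + 1 - n : ℕ) : ℝ≥0∞) * (((d + 1 : ℕ) : ℝ≥0∞) *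
        ∫⁻ c, ‖c 0‖ₑ ^ 2 * w (sqNorm c) ∂π) ≤ ((d + 1 : ℕ) : ℝ≥0∞) *
        ∫⁻ c, sqNorm (c - φ c) * w (sqNorm c) ∂π := by
      have hR : ∫⁻ c, sqNorm (c - φ c) * w (sqNorm c) ∂π =
          ∫⁻ c, sqNorm (c - U.symm (φ (U c))) * w (sqNorm c) ∂π := by
        rw [← hUm.lintegral_comp (by fun_prop)]
        refine lintegral_congr fun c => ?_
        rw [hU, ← hUsymm (U c - φ (U c)), map_sub, LinearEquiv.symm_apply_apply]
      have hmR : Measurable fun c => sqNorm (c - U.symm (φ (U c))) * w (sqNorm c) :=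
        (hs'.comp (measurable_id.sub (hUsm.comp (hm.comp hUm')))).mul (hw.comp hs')
      have hL : ((d + 1 : ℕ) : ℝ≥0∞) * ∫⁻ c, ‖c 0‖ₑ ^ 2 * w (sqNorm c) ∂π =
          ∫⁻ c, sqNorm (Fin.tail c) * w (sqNorm c) ∂π := by
        have h1 : ∀ c : Fin (d + 1 + 1) → 𝕜, sqNorm (Fin.tail c) * w (sqNorm c) =
            ∑ i : Fin (d + 1), ‖c i.succ‖ₑ ^ 2 * w (sqNorm c) := fun c => by
          rw [← sum_mul]; rfl
        simp_rw [h1]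
        rw [lintegral_finsetSum _ fun k _ => by fun_prop,
          sum_congr rfl fun k _ => lintegral_coord_eq ν hw (Fin.succ k) 0]
        simp [π]
      rw [hR, hL, lintegral_cons ν hmR,
        lintegral_cons ν (f := fun c => sqNorm (Fin.tail c) * w (sqNorm c))
          ((hs.comp htail).mul (hw.comp hs')),
        ← lintegral_const_mul' _ _ (by finiteness), ← lintegral_const_mul' _ _ (by finiteness)]
      refine lintegral_mono fun y => ?_
      simpa [sqNorm_cons] using key y
    have hfin : ((d + 1 - n : ℕ) : ℝ≥0∞) * ∫⁻ c, ‖c 0‖ₑ ^ 2 * w (sqNorm c) ∂π ≤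
        ∫⁻ c, sqNorm (c - φ c) * w (sqNorm c) ∂π := by
      rw [← mul_assoc, mul_comm (((d + 1 - n : ℕ)) : ℝ≥0∞), mul_assoc] at hint
      exact (ENNReal.mul_le_mul_iff_right (by simp) (by finiteness)).1 hint
    rw [lintegral_sqNorm_eq ν hw 0, ← mul_assoc,
      mul_comm (((d + 1 + 1 - (n + 1) : ℕ)) : ℝ≥0∞), mul_assoc, Nat.add_sub_add_right]
    exact mul_le_mul_right hfin _

end SphericalAverage

/-! ### Singular values and projections -/

section Spectral

variable {D : Type uD} [MeasurableSpace D] {𝕜 : Type uK} [RCLike 𝕜] {μ : Measure D}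
  {F : Type uF} [NormedAddCommGroup F] [InnerProductSpace 𝕜 F] [CompleteSpace F]
  {T : F →L[𝕜] Lp 𝕜 2 μ} (S : SVD T)

namespace SVD

theorem inner_T_b {k : ℕ} (hk : 1 ≤ k) (hkN : (k : ℕ∞) ≤ S.N) (f : F) :
    inner 𝕜 (T (S.b k)) (T f) = (S.eig k : 𝕜) * inner 𝕜 (S.b k) f := by
  rw [← ContinuousLinearMap.adjoint_inner_left, S.eigenvector k hk hkN, inner_smul_left]
  simp

theorem eig_mul_norm_sq {k : ℕ} (hk : 1 ≤ k) (hkN : (k : ℕ∞) ≤ S.N) :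
    S.eig k * ‖S.b k‖ ^ 2 = 1 := by
  have h := S.inner_T_b hk hkN (S.b k)
  rw [inner_self_eq_norm_sq_to_K, inner_self_eq_norm_sq_to_K, S.normalized k hk hkN] at h
  have h' : ((1 : ℝ) : 𝕜) = ((S.eig k * ‖S.b k‖ ^ 2 : ℝ) : 𝕜) := by simpa using h
  exact (RCLike.ofReal_injective h').symm

theorem eig_pos {k : ℕ} (hk : 1 ≤ k) (hkN : (k : ℕ∞) ≤ S.N) : 0 < S.eig k := by
  have h := S.eig_mul_norm_sq hk hkN
  by_contra hle
  nlinarith [mul_nonneg (neg_nonneg.2 (not_lt.1 hle)) (sq_nonneg ‖S.b k‖)]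

theorem sigma_pos {k : ℕ} (hk : 1 ≤ k) (hkN : (k : ℕ∞) ≤ S.N) : 0 < S.sigma k :=
  Real.sqrt_pos.2 (S.eig_pos hk hkN)

theorem eig_nonneg {k : ℕ} (hk : 1 ≤ k) : 0 ≤ S.eig k := by
  by_cases h : (k : ℕ∞) ≤ S.N
  · exact (S.eig_pos hk h).le
  · rw [S.eig_eq_zero k (not_le.1 h)]

theorem sigma_sq {k : ℕ} (hk : 1 ≤ k) : S.sigma k ^ 2 = S.eig k :=
  Real.sq_sqrt (S.eig_nonneg hk)

theorem sigma_nonneg (k : ℕ) : 0 ≤ S.sigma k := Real.sqrt_nonneg _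

theorem sigma_antitone {j k : ℕ} (hj : 1 ≤ j) (hjk : j ≤ k) : S.sigma k ≤ S.sigma j :=
  Real.sqrt_le_sqrt (S.antitone j k hj hjk)

theorem inner_T_b_T_b {j k : ℕ} (hj : 1 ≤ j) (hjN : (j : ℕ∞) ≤ S.N) (hk : 1 ≤ k)
    (hkN : (k : ℕ∞) ≤ S.N) :
    inner 𝕜 (T (S.b j)) (T (S.b k)) = if j = k then (1 : 𝕜) else 0 := by
  split_ifs with h
  · rw [h, inner_self_eq_norm_sq_to_K, S.normalized k hk hkN]
    simp
  · rw [S.inner_T_b hj hjN, S.orthogonal j k hj hjN hk hkN h, mul_zero]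

theorem orthonormal_T_b (hN : S.N = ⊤) : Orthonormal 𝕜 fun i : ℕ => T (S.b (i + 1)) := by
  rw [orthonormal_iff_ite]
  intro i j
  rw [S.inner_T_b_T_b (by omega) (by simp [hN]) (by omega) (by simp [hN])]
  simp

/-- If the number `N` of singular values were finite and positive, then `σ(2N) = 0 < σ(N)`, which
the decay condition excludes. -/
theorem N_eq_zero_or_top {r : ℝ}
    (hσ : ∀ n : ℕ, 1 ≤ n → S.sigma (2 * n) ≥ (2 : ℝ) ^ (-r) * S.sigma n) :
    S.N = 0 ∨ S.N = ⊤ := by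
  by_contra! h
  obtain ⟨h0, htop⟩ := h
  obtain ⟨M, hM⟩ := ENat.ne_top_iff_exists.1 htop
  have hM1 : 1 ≤ M := by
    rw [Nat.one_le_iff_ne_zero]
    rintro rfl
    exact h0 (by simp [← hM])
  have h1 := hσ M hM1
  have h2 : S.sigma (2 * M) = 0 := by
    rw [sigma, S.eig_eq_zero _ (by rw [← hM]; exact_mod_cast (by omega : M < 2 * M)),
      Real.sqrt_zero]
  have h3 := S.sigma_pos hM1 hM.le
  have h4 : 0 < (2 : ℝ) ^ (-r) * S.sigma M := by positivity
  linarith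

theorem norm_sum_smul_b_sq {s : Finset ℕ} (c : ℕ → 𝕜) (hN : S.N = ⊤) :
    ‖∑ i ∈ s, c i • S.b (i + 1)‖ ^ 2 = ∑ i ∈ s, ‖c i‖ ^ 2 * ‖S.b (i + 1)‖ ^ 2 := by
  have h : inner 𝕜 (∑ i ∈ s, c i • S.b (i + 1)) (∑ i ∈ s, c i • S.b (i + 1)) =
      ((∑ i ∈ s, ‖c i‖ ^ 2 * ‖S.b (i + 1)‖ ^ 2 : ℝ) : 𝕜) := by
    rw [sum_inner]
    push_cast
    refine sum_congr rfl fun i hi => ?_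
    rw [inner_sum, sum_eq_single i]
    · rw [inner_smul_left, inner_smul_right, inner_self_eq_norm_sq_to_K, ← mul_assoc,
        RCLike.conj_mul]
    · intro j _ hji
      rw [inner_smul_left, inner_smul_right, S.orthogonal (i + 1) (j + 1) (by omega) (by simp [hN])
        (by omega) (by simp [hN]) (by omega)]
      simp
    · exact fun h => absurd hi h
  rw [inner_self_eq_norm_sq_to_K] at h
  exact_mod_cast h

theorem norm_sum_smul_T_b_sq {s : Finset ℕ} (c : ℕ → 𝕜) (hN : S.N = ⊤) :
    ‖∑ i ∈ s, c i • T (S.b (i + 1))‖ ^ 2 = ∑ i ∈ s, ‖c i‖ ^ 2 := by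
  have h := (S.orthonormal_T_b hN).inner_sum c c s
  rw [inner_self_eq_norm_sq_to_K] at h
  simp only [RCLike.conj_mul] at h
  exact_mod_cast h

/-- The orthogonal projection of `h` onto the span of `b 1, …, b m` in `L²`. -/
noncomputable def proj (m : ℕ) (h : Lp 𝕜 2 μ) : Lp 𝕜 2 μ :=
  ∑ j ∈ Icc 1 m, (inner 𝕜 (T (S.b j)) h : 𝕜) • T (S.b j)

theorem proj_sub (m : ℕ) (h h' : Lp 𝕜 2 μ) : S.proj m (h - h') = S.proj m h - S.proj m h' := by
  simp only [proj, inner_sub_right, sub_smul, sum_sub_distrib]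

theorem continuous_proj (m : ℕ) : Continuous (S.proj m) := by
  unfold proj
  fun_prop

theorem proj_sum_smul (hN : S.N = ⊤) {m M : ℕ} (hM : M ≤ m) (c : ℕ → 𝕜) :
    S.proj m (∑ j ∈ Icc 1 M, c j • T (S.b j)) = ∑ j ∈ Icc 1 M, c j • T (S.b j) := by
  rw [proj, ← sum_subset (Icc_subset_Icc_right hM) fun j hj hjM => ?_]
  · refine sum_congr rfl fun j hj => ?_
    have hj' := mem_Icc.1 hj
    rw [inner_sum, sum_eq_single j]
    · rw [inner_smul_right, S.inner_T_b_T_b (by omega) (by simp [hN]) (by omega) (by simp [hN])]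
      simp
    · intro i hi hij
      have hi' := mem_Icc.1 hi
      rw [inner_smul_right, S.inner_T_b_T_b (by omega) (by simp [hN]) (by omega) (by simp [hN]),
        if_neg hij.symm, mul_zero]
    · exact fun h => absurd hj h
  · have hj' := mem_Icc.1 hj
    rw [inner_sum, sum_eq_zero, zero_smul]
    intro i hi
    have hi' := mem_Icc.1 hi
    rw [inner_smul_right, S.inner_T_b_T_b (by omega) (by simp [hN]) (by omega) (by simp [hN]),
      if_neg (by rintro rfl; exact hjM hi), mul_zero]

/-- Pythagoras for the error of an approximation with arbitrary coefficients. -/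
theorem norm_sub_sum_sq (hN : S.N = ⊤) (m : ℕ) (h : Lp 𝕜 2 μ) (c : ℕ → 𝕜) :
    ‖h - ∑ j ∈ Icc 1 m, c j • T (S.b j)‖ ^ 2 = ‖h - S.proj m h‖ ^ 2 +
      ∑ j ∈ Icc 1 m, ‖inner 𝕜 (T (S.b j)) h - c j‖ ^ 2 := by
  have horth : ∀ i ∈ Icc 1 m, inner 𝕜 (T (S.b i)) (h - S.proj m h) = 0 := by
    intro i hi
    have hi' := mem_Icc.1 hi
    rw [inner_sub_right, proj, inner_sum, sum_eq_single i]
    · rw [inner_smul_right, S.inner_T_b_T_b (by omega) (by simp [hN]) (by omega) (by simp [hN])]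
      simp
    · intro j hj hij
      have hj' := mem_Icc.1 hj
      rw [inner_smul_right, S.inner_T_b_T_b (by omega) (by simp [hN]) (by omega) (by simp [hN]),
        if_neg hij.symm, mul_zero]
    · exact fun h => absurd hi h
  have h1 : h - ∑ j ∈ Icc 1 m, c j • T (S.b j) = (h - S.proj m h) +
      ∑ j ∈ Icc 1 m, (inner 𝕜 (T (S.b j)) h - c j) • T (S.b j) := by
    simp only [proj, sub_smul, sum_sub_distrib]
    abel
  have h2 : inner 𝕜 (h - S.proj m h)
      (∑ j ∈ Icc 1 m, (inner 𝕜 (T (S.b j)) h - c j) • T (S.b j)) = 0 := by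
    rw [inner_sum, sum_eq_zero]
    intro i hi
    rw [inner_smul_right, inner_eq_zero_symm.1 (horth i hi), mul_zero]
  have h3 : ∀ a : ℕ → 𝕜, ‖∑ j ∈ Icc 1 m, a j • T (S.b j)‖ ^ 2 = ∑ j ∈ Icc 1 m, ‖a j‖ ^ 2 := by
    intro a
    have h4 := S.norm_sum_smul_T_b_sq (s := range m) (fun i => a (i + 1)) hN
    rw [← Finset.Ico_add_one_right_eq_Icc, sum_Ico_eq_sum_range, sum_Ico_eq_sum_range]
    simpa [add_comm] using h4
  rw [h1, ← h3]
  have h5 := norm_add_sq_eq_norm_sq_add_norm_sq_of_inner_eq_zero _ _ h2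
  simpa only [sq] using h5

/-- The singular value `σ(m+1)` bounds the error of the orthogonal projection onto the span of
`b 1, …, b m` on the unit ball of `F`. -/
theorem norm_sub_proj_sq_le (hN : S.N = ⊤) (m : ℕ) (f : F) :
    ‖T f - S.proj m (T f)‖ ^ 2 ≤ S.eig (m + 1) * ‖f‖ ^ 2 := by
  -- Both sides are continuous, so that it is enough to consider finite linear combinations.
  have hcl : IsClosed {f : F | ‖T f - S.proj m (T f)‖ ^ 2 ≤ S.eig (m + 1) * ‖f‖ ^ 2} := by
    have := S.continuous_proj m
    exact isClosed_le (by fun_prop) (by fun_prop)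
  have hset : {f | ∃ k : ℕ, 1 ≤ k ∧ (k : ℕ∞) ≤ S.N ∧ f = S.b k} =
      Set.range fun i : ℕ => S.b (i + 1) := by
    ext f
    constructor
    · rintro ⟨k, hk, -, rfl⟩
      exact ⟨k - 1, by simp only [Nat.sub_add_cancel hk]⟩
    · rintro ⟨i, rfl⟩
      exact ⟨i + 1, by omega, by simp [hN], rfl⟩
  have hd := S.dense_span
  rw [hset] at hd
  have hmem : f ∈ closure (Submodule.span 𝕜 (Set.range fun i : ℕ => S.b (i + 1)) : Set F) := by
    rw [← Submodule.topologicalClosure_coe, hd]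
    trivial
  refine closure_minimal ?_ hcl hmem
  intro g hg
  obtain ⟨c, rfl⟩ := (Finsupp.mem_span_range_iff_exists_finsupp).1 hg
  rw [Finsupp.sum]
  set s := c.support
  have hT : T (∑ i ∈ s, c i • S.b (i + 1)) = ∑ i ∈ s, c i • T (S.b (i + 1)) := by
    simp [map_sum]
  have hproj : S.proj m (T (∑ i ∈ s, c i • S.b (i + 1))) =
      ∑ i ∈ s with i < m, c i • T (S.b (i + 1)) := by
    have hin : ∀ i, inner 𝕜 (T (S.b (i + 1))) (∑ i ∈ s, c i • T (S.b (i + 1))) = c i := by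
      intro i
      rw [inner_sum]
      simp only [inner_smul_right, S.inner_T_b_T_b (Nat.le_add_left 1 _) (by simp [hN])
        (Nat.le_add_left 1 _) (by simp [hN])]
      simp only [add_left_inj, mul_ite, mul_one, mul_zero, sum_ite_eq, s, Finsupp.mem_support_iff,
        ne_eq, ite_not, ite_eq_right_iff]
      exact Eq.symm
    rw [hT, proj, ← Finset.Ico_add_one_right_eq_Icc, sum_Ico_eq_sum_range]
    simp only [add_comm 1, hin, Nat.add_sub_cancel]
    rw [sum_filter]
    have h1 : ∀ i ∈ s ∪ range m, i ∉ s → (if i < m then c i • T (S.b (i + 1)) else 0) = 0 := by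
      intro i _ hi
      rw [Finsupp.notMem_support_iff.1 hi]
      simp
    rw [sum_subset subset_union_left h1, ← sum_filter]
    refine sum_congr ?_ fun _ _ => rfl
    ext i
    simp only [mem_range, mem_filter, mem_union]
    tauto
  have hdiff : T (∑ i ∈ s, c i • S.b (i + 1)) - S.proj m (T (∑ i ∈ s, c i • S.b (i + 1))) =
      ∑ i ∈ s with ¬ i < m, c i • T (S.b (i + 1)) := by
    rw [hproj, hT, ← sum_filter_add_sum_filter_not s (fun i => i < m)]
    abel
  rw [Set.mem_ofPred_eq, hdiff, S.norm_sum_smul_T_b_sq _ hN, S.norm_sum_smul_b_sq _ hN, mul_sum]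
  refine (sum_le_sum fun i hi => ?_).trans
    (sum_le_sum_of_subset_of_nonneg (filter_subset _ _) fun i _ _ =>
      mul_nonneg (S.eig_nonneg (by omega)) (by positivity))
  have hi' := (mem_filter.1 hi).2
  have h1 := S.antitone (m + 1) (i + 1) (by omega) (by omega)
  have h2 := S.eig_mul_norm_sq (k := i + 1) (by omega) (by simp [hN])
  calc ‖c i‖ ^ 2 = ‖c i‖ ^ 2 * (S.eig (i + 1) * ‖S.b (i + 1)‖ ^ 2) := by rw [h2, mul_one]
    _ = S.eig (i + 1) * (‖c i‖ ^ 2 * ‖S.b (i + 1)‖ ^ 2) := by ring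
    _ ≤ _ := mul_le_mul_of_nonneg_right h1 (by positivity)

theorem norm_T_sq_le (hN : S.N = ⊤) (f : F) : ‖T f‖ ^ 2 ≤ S.eig 1 * ‖f‖ ^ 2 := by
  simpa [proj] using S.norm_sub_proj_sq_le hN 0 f

end SVD

end Spectral

/-! ### The lower bound for all randomized algorithms -/

section LowerBound

variable {D : Type uD} [MeasurableSpace D] {𝕜 : Type uK} [RCLike 𝕜] {μ : Measure D}
  {F : Type uF} [NormedAddCommGroup F] [InnerProductSpace 𝕜 F]

theorem lintegral_le_randError_sq {T : F →L[𝕜] Lp 𝕜 2 μ} {V : Submodule 𝕜 (D → 𝕜)}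
    {Ω : Type uΩ} [MeasurableSpace Ω] (P : Measure Ω) (A : Ω → (D → 𝕜) → Lp 𝕜 2 μ)
    {f : F} (hf : ‖f‖ ≤ 1) {g : D → 𝕜} (hg : g ∈ V) (hfg : g =ᵐ[μ] T f) :
    ∫⁻ ω, ‖T f - A ω g‖ₑ ^ 2 ∂P ≤ randError T V P A ^ 2 := by
  have h : (∫⁻ ω, ‖T f - A ω g‖ₑ ^ 2 ∂P) ^ (1 / 2 : ℝ) ≤ randError T V P A :=
    le_iSup₂_of_le f hf (le_iSup₂_of_le g hg (le_iSup_of_le hfg le_rfl))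
  calc ∫⁻ ω, ‖T f - A ω g‖ₑ ^ 2 ∂P
      = ((∫⁻ ω, ‖T f - A ω g‖ₑ ^ 2 ∂P) ^ (1 / 2 : ℝ)) ^ 2 := by
        rw [← ENNReal.rpow_natCast, ← ENNReal.rpow_mul]
        norm_num
    _ ≤ _ := by gcongr

/-- The shell `1/2 ≤ |c|² ≤ 1` has positive and finite measure. -/
theorem measure_shell {d : ℕ} (hd : 0 < d) (ν : Measure 𝕜) [ν.IsAddHaarMeasure] :
    Measure.pi (fun _ : Fin d => ν) (sqNorm ⁻¹' Set.Icc 2⁻¹ 1) ≠ 0 ∧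
      Measure.pi (fun _ : Fin d => ν) (sqNorm ⁻¹' Set.Icc 2⁻¹ 1) ≠ ∞ := by
  set π : Measure (Fin d → 𝕜) := Measure.pi fun _ => ν
  constructor
  · have hB : Continuous fun c : Fin d → 𝕜 => ∑ i, ‖c i‖ ^ 2 := by fun_prop
    let B : Set (Fin d → 𝕜) := {c | ∑ i, ‖c i‖ ^ 2 ∈ Set.Ioo (1 / 2) 1}
    have hBo : IsOpen B := isOpen_Ioo.preimage hB
    have hne : B.Nonempty := by
      refine ⟨Pi.single ⟨0, hd⟩ ((4 / 5 : ℝ) : 𝕜), ?_⟩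
      change (∑ i : Fin d, ‖(Pi.single ⟨0, hd⟩ ((4 / 5 : ℝ) : 𝕜) : Fin d → 𝕜) i‖ ^ 2) ∈
        Set.Ioo (1 / 2 : ℝ) 1
      rw [sum_eq_single ⟨0, hd⟩ (fun j _ hj => by simp [hj]) (by simp)]
      rw [Pi.single_eq_same, RCLike.norm_ofReal]
      norm_num
    refine ((hBo.measure_pos π hne).trans_le (measure_mono fun c hc => ?_)).ne'
    rw [Set.mem_preimage, sqNorm_eq_ofReal]
    have h1 : 1 / 2 < ∑ i, ‖c i‖ ^ 2 := hc.1
    have h2 : ∑ i, ‖c i‖ ^ 2 < 1 := hc.2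
    constructor
    · rw [show (2⁻¹ : ℝ≥0∞) = ENNReal.ofReal (1 / 2) by
        rw [ENNReal.ofReal_div_of_pos two_pos]; simp]
      exact ENNReal.ofReal_le_ofReal h1.le
    · simpa using h2.le
  · refine ((measure_mono ?_).trans_lt (measure_closedBall_lt_top (μ := π) (x := 0) (r := 1))).ne
    intro c hc
    rw [mem_closedBall_zero_iff, pi_norm_le_iff_of_nonneg zero_le_one]
    intro i
    have hc' : sqNorm c ≤ 1 := hc.2
    rw [sqNorm_eq_ofReal, ENNReal.ofReal_le_one] at hc'
    have h2 := single_le_sum (f := fun i => ‖c i‖ ^ 2) (fun i _ => by positivity) (mem_univ i)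
    exact (sq_le_one_iff₀ (norm_nonneg _)).1 (h2.trans hc')

/-- If a vector is distributed uniformly on the shell `1/2 ≤ |c|² ≤ 1` in `𝕜^(2n)`, then no
adaptive algorithm with `n` linear functionals can recover it with a mean square error less than
`1/4`. -/
theorem quarter_shell_le {X G : Type*} (ν : Measure 𝕜) [ν.IsAddHaarMeasure] {n : ℕ} (hn : 1 ≤ n)
    (t : SamplingTree X 𝕜 G n) (L : (Fin (2 * n) → 𝕜) →ₗ[𝕜] (X → 𝕜))
    (out : G → Fin (2 * n) → 𝕜) (hm : Measurable (fun c => out (t.eval (L c)))) :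
    4⁻¹ * Measure.pi (fun _ : Fin (2 * n) => ν) (sqNorm ⁻¹' Set.Icc 2⁻¹ 1) ≤
      ∫⁻ c in sqNorm ⁻¹' Set.Icc 2⁻¹ 1, sqNorm (c - out (t.eval (L c)))
        ∂(Measure.pi fun _ : Fin (2 * n) => ν) := by
  set π : Measure (Fin (2 * n) → 𝕜) := Measure.pi fun _ => ν
  let w : ℝ≥0∞ → ℝ≥0∞ := (Set.Icc 2⁻¹ 1).indicator 1
  have hw : Measurable w := measurable_one.indicator measurableSet_Icc
  have hs : MeasurableSet ((sqNorm : (Fin (2 * n) → 𝕜) → ℝ≥0∞) ⁻¹' Set.Icc 2⁻¹ 1) :=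
    measurable_sqNorm measurableSet_Icc
  have hint : ∀ f : (Fin (2 * n) → 𝕜) → ℝ≥0∞,
      ∫⁻ c, f c * w (sqNorm c) ∂π = ∫⁻ c in sqNorm ⁻¹' Set.Icc 2⁻¹ 1, f c ∂π := by
    intro f
    rw [← lintegral_indicator hs]
    refine lintegral_congr fun c => ?_
    by_cases hc : c ∈ (sqNorm : (Fin (2 * n) → 𝕜) → ℝ≥0∞) ⁻¹' Set.Icc 2⁻¹ 1
    · rw [Set.indicator_of_mem hc, show w (sqNorm c) = 1 from Set.indicator_of_mem hc 1, mul_one]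
    · rw [Set.indicator_of_notMem hc, show w (sqNorm c) = 0 from Set.indicator_of_notMem hc 1,
        mul_zero]
  have h := lintegral_adaptive_ge ν t (0 : X → 𝕜) L out hw (by simpa only [zero_add] using hm)
  simp only [zero_add] at h
  rw [hint, hint] at h
  -- On the shell, the mean square of `c` is at least `1/2`, and half of it remains unknown.
  have h1 : 2⁻¹ * π (sqNorm ⁻¹' Set.Icc 2⁻¹ 1) ≤
      ∫⁻ c in sqNorm ⁻¹' Set.Icc 2⁻¹ 1, sqNorm c ∂π := by
    rw [← setLIntegral_const]
    exact setLIntegral_mono measurable_sqNorm fun c hc => hc.1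
  rw [show 2 * n - n = n by omega] at h
  push_cast at h
  rw [mul_comm 2 (n : ℝ≥0∞), mul_assoc] at h
  have h2 := (ENNReal.mul_le_mul_iff_right (by simp; omega) (by finiteness)).1 h
  have h3 : (4⁻¹ : ℝ≥0∞) = 2⁻¹ * 2⁻¹ := by
    rw [← ENNReal.mul_inv (by simp) (by simp)]; norm_num
  calc _ = 2⁻¹ * (2⁻¹ * π (sqNorm ⁻¹' Set.Icc 2⁻¹ 1)) := by rw [h3, mul_assoc]
    _ ≤ 2⁻¹ * (2 * ∫⁻ c in sqNorm ⁻¹' Set.Icc 2⁻¹ 1, sqNorm (c - out (t.eval (L c))) ∂π) := by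
      exact mul_le_mul_right (h1.trans h2) _
    _ = _ := by rw [← mul_assoc, ENNReal.inv_mul_cancel (by simp) (by simp), one_mul]

variable [CompleteSpace F]

/-- The lower bound for all randomized algorithms. The supremum over the unit ball is at least the
average over a shell of radius about `σ(2n)` in the span of `b 1, …, b (2n)`; after the expectation
and the average are interchanged, the bound holds for every single realization. Since `L²` need not
be separable, outputs are projected onto this span before any measurability is used. -/
theorem sigma_div_two_le_minRandError {T : F →L[𝕜] Lp 𝕜 2 μ} {V : Submodule 𝕜 (D → 𝕜)}
    (hV : IsFunctionSpace T V) (S : SVD T) (hN : S.N = ⊤) {n : ℕ} (hn : 1 ≤ n) :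
    ENNReal.ofReal (S.sigma (2 * n) / 2) ≤ minRandError.{uD, uK, uF, uΩ} T V n := by
  refine le_iInf fun Ω => le_iInf fun _ => le_iInf fun P => le_iInf fun _ => le_iInf fun A =>
    le_iInf fun hA => ?_
  set s := S.sigma (2 * n) with hs_def
  have hs : 0 < s := S.sigma_pos (by omega) (by simp [hN])
  have hs𝕜 : (s : 𝕜) ≠ 0 := RCLike.ofReal_ne_zero.2 hs.ne'
  choose v hvV hv using fun i : Fin (2 * n) => hV.exists_function (S.b (i + 1))
  let v' : Fin (2 * n) → D → 𝕜 := fun i => (s : 𝕜) • v i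
  have hv'V : ∀ i, v' i ∈ V := fun i => V.smul_mem _ (hvV i)
  let L : (Fin (2 * n) → 𝕜) →ₗ[𝕜] (D → 𝕜) := Fintype.linearCombination 𝕜 v'
  have hL : ∀ c, L c = ∑ i, c i • v' i := fun c => rfl
  have hLV : ∀ c, L c ∈ V := fun c => by
    rw [hL]
    exact V.sum_mem fun i _ => V.smul_mem _ (hv'V i)
  let f : (Fin (2 * n) → 𝕜) → F := fun c => ∑ i, c i • (s : 𝕜) • S.b (i + 1)
  have hLf : ∀ c, L c =ᵐ[μ] T (f c) := by
    intro c
    have h1 : T (f c) = ∑ i, (c i * s) • T (S.b (i + 1)) := by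
      simp [f, map_sum, smul_smul]
    rw [h1]
    refine Filter.EventuallyEq.trans ?_ (Lp.coeFn_finsetSum _ _).symm
    have h2 : ∀ i, (v' i : D → 𝕜) =ᵐ[μ] (s : 𝕜) • ⇑(T (S.b (i + 1))) := fun i =>
      (hv i).const_smul (s : 𝕜)
    have h3 : ∀ i, ⇑((c i * (s : 𝕜)) • T (S.b (i + 1))) =ᵐ[μ]
        (c i * (s : 𝕜)) • ⇑(T (S.b (i + 1))) := fun i => Lp.coeFn_smul _ _
    filter_upwards [eventually_countable_forall.2 h2, eventually_countable_forall.2 h3] with x h2 h3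
    simp [hL, h2, h3, mul_assoc]
  have hf : ∀ c, sqNorm c ≤ 1 → ‖f c‖ ≤ 1 := by
    intro c hc
    rw [sqNorm_eq_ofReal, ENNReal.ofReal_le_one] at hc
    let c' : ℕ → 𝕜 := fun i => if h : i < 2 * n then c ⟨i, h⟩ * s else 0
    have h1 : f c = ∑ i ∈ range (2 * n), c' i • S.b (i + 1) := by
      rw [← Fin.sum_univ_eq_sum_range (fun i => c' i • S.b (i + 1))]
      simp [f, c', smul_smul]
    have h2 : ‖f c‖ ^ 2 ≤ 1 := by
      rw [h1, S.norm_sum_smul_b_sq _ hN,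
        ← Fin.sum_univ_eq_sum_range (fun i => ‖c' i‖ ^ 2 * ‖S.b (i + 1)‖ ^ 2)]
      refine (sum_le_sum fun i _ => ?_).trans hc
      have h3 : s ^ 2 * ‖S.b (i + 1)‖ ^ 2 ≤ 1 := by
        rw [hs_def, S.sigma_sq (by omega), ← S.eig_mul_norm_sq (k := i + 1) (by omega)
          (by simp [hN])]
        exact mul_le_mul_of_nonneg_right (S.antitone _ _ (by omega) (by omega)) (by positivity)
      have h4 : ‖c' i‖ ^ 2 = ‖c i‖ ^ 2 * s ^ 2 := by
        simp [c', mul_pow]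
      rw [h4, mul_assoc]
      exact mul_le_of_le_one_right (by positivity) h3
    exact (sq_le_one_iff₀ (norm_nonneg _)).1 h2
  -- The coordinates of an output with respect to the functions `s • b i`.
  let out : Lp 𝕜 2 μ → Fin (2 * n) → 𝕜 := fun h i => (s : 𝕜)⁻¹ * inner 𝕜 (T (S.b (i + 1))) h
  have hout : Measurable[borel (Lp 𝕜 2 μ), inferInstance] out := by
    borelize ↥(Lp 𝕜 2 μ)
    have : Continuous out := by fun_prop
    exact this.measurable
  have houtsub : ∀ h h', out (h - h') = out h - out h' := by
    intro h h'
    ext i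
    simp [out, inner_sub_right, mul_sub]
  have houtT : ∀ c, out (T (f c)) = c := by
    intro c
    ext i
    have h1 : T (f c) = ∑ i, (c i * s) • T (S.b (i + 1)) := by
      simp [f, map_sum, smul_smul]
    simp only [out, h1, inner_sum, inner_smul_right]
    rw [sum_eq_single i]
    · rw [S.inner_T_b_T_b (by omega) (by simp [hN]) (by omega) (by simp [hN])]
      field_simp
      simp
    · intro j _ hji
      rw [S.inner_T_b_T_b (by omega) (by simp [hN]) (by omega) (by simp [hN]), if_neg, mul_zero]
      intro h
      exact hji (Fin.ext (by omega))
    · simp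
  have houtle : ∀ h, ENNReal.ofReal (s ^ 2) * sqNorm (out h) ≤ ‖h‖ₑ ^ 2 := by
    intro h
    rw [sqNorm_eq_ofReal, enorm_sq_eq_ofReal, ← ENNReal.ofReal_mul (by positivity)]
    refine ENNReal.ofReal_le_ofReal ?_
    have h1 := (S.orthonormal_T_b hN).sum_inner_products_le (s := range (2 * n)) h
    rw [← Fin.sum_univ_eq_sum_range (fun i => ‖inner 𝕜 (T (S.b (i + 1))) h‖ ^ 2)] at h1
    refine le_of_eq_of_le ?_ h1
    rw [mul_sum]
    refine sum_congr rfl fun i _ => ?_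
    simp only [out, norm_mul, norm_inv, RCLike.norm_ofReal, abs_of_pos hs, mul_pow]
    field_simp
  have hmeas : Measurable fun p : (Fin (2 * n) → 𝕜) × Ω => out (A p.2 (L p.1)) :=
    hout.comp (hA.measurable (2 * n) v' hv'V)
  let ν : Measure 𝕜 := Measure.addHaar
  set π : Measure (Fin (2 * n) → 𝕜) := Measure.pi fun _ => ν with hπ
  set B : Set (Fin (2 * n) → 𝕜) := sqNorm ⁻¹' Set.Icc 2⁻¹ 1 with hB
  have hBm : MeasurableSet B := measurable_sqNorm measurableSet_Icc
  obtain ⟨hB0, hBtop⟩ := measure_shell (d := 2 * n) (by omega) ν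
  rw [← hπ, ← hB] at hB0 hBtop
  set e := randError T V P A
  have hlow : ∀ ω, 4⁻¹ * π B ≤ ∫⁻ c in B, sqNorm (c - out (A ω (L c))) ∂π := by
    intro ω
    obtain ⟨t, ht⟩ := hA.samples ω
    have h1 : ∀ c, A ω (L c) = t.eval (L c) := fun c => ht _ (hLV c)
    have h2 : Measurable fun c => out (t.eval (L c)) := by
      simp only [← h1]
      exact hmeas.comp (measurable_id.prodMk measurable_const)
    simp only [h1]
    exact quarter_shell_le ν hn t L out h2
  have hup : ∀ c ∈ B, ∫⁻ ω, ENNReal.ofReal (s ^ 2) * sqNorm (c - out (A ω (L c))) ∂P ≤ e ^ 2 := by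
    intro c hc
    refine (lintegral_mono fun ω => ?_).trans
      (lintegral_le_randError_sq P A (hf c hc.2) (hLV c) (hLf c))
    have h1 := houtle (T (f c) - A ω (L c))
    rwa [houtsub, houtT] at h1
  have hJ : Measurable fun p : (Fin (2 * n) → 𝕜) × Ω =>
      ENNReal.ofReal (s ^ 2) * sqNorm (p.1 - out (A p.2 (L p.1))) :=
    (measurable_sqNorm.comp (measurable_fst.sub hmeas)).const_mul _
  have hmain : ENNReal.ofReal ((s / 2) ^ 2) * π B ≤ e ^ 2 * π B := by
    calc ENNReal.ofReal ((s / 2) ^ 2) * π B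
        = ∫⁻ _ω, ENNReal.ofReal (s ^ 2) * (4⁻¹ * π B) ∂P := by
          rw [lintegral_const, measure_univ, mul_one, ← mul_assoc, div_pow,
            ENNReal.ofReal_div_of_pos (by positivity), div_eq_mul_inv]
          norm_num
      _ ≤ ∫⁻ ω, ∫⁻ c in B, ENNReal.ofReal (s ^ 2) * sqNorm (c - out (A ω (L c))) ∂π ∂P := by
          refine lintegral_mono fun ω => ?_
          rw [lintegral_const_mul' _ _ (by finiteness)]
          gcongr
          exact hlow ω
      _ = ∫⁻ c in B, ∫⁻ ω, ENNReal.ofReal (s ^ 2) * sqNorm (c - out (A ω (L c))) ∂P ∂π :=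
          (lintegral_lintegral_swap hJ.aemeasurable).symm
      _ ≤ ∫⁻ _c in B, e ^ 2 ∂π := setLIntegral_mono measurable_const hup
      _ = e ^ 2 * π B := by rw [setLIntegral_const]
  have hsq := (ENNReal.mul_le_mul_iff_left hB0 hBtop).1 hmain
  rw [ENNReal.ofReal_pow (by positivity)] at hsq
  exact (ENNReal.pow_le_pow_left_iff two_ne_zero).1 hsq

end LowerBound

/-! ### The mean square error of one correction step -/

section OneStep

theorem integral_sub_mean_sq_le {Ω : Type*} [MeasurableSpace Ω] (P : Measure Ω)
    [IsProbabilityMeasure P] {n : ℕ} (hn : n ≠ 0) {Y : Fin n → Ω → ℝ} (hY : ∀ i, MemLp (Y i) 2 P)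
    (hind : Pairwise fun i j => IndepFun (Y i) (Y j) P) {a : ℝ} (ha : ∀ i, ∫ ω, Y i ω ∂P = a) :
    ∫ ω, (a - (1 / (n : ℝ)) * ∑ i, Y i ω) ^ 2 ∂P ≤
      (1 / (n : ℝ) ^ 2) * ∑ i, ∫ ω, Y i ω ^ 2 ∂P := by
  have hn' : (n : ℝ) ≠ 0 := by exact_mod_cast hn
  have hsum : MemLp (∑ i, Y i) 2 P := memLp_finsetSum' _ fun i _ => hY i
  have hmean : ∫ ω, (∑ i, Y i) ω ∂P = n * a := by
    simp only [Finset.sum_apply]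
    rw [integral_finsetSum _ fun i _ => (hY i).integrable one_le_two]
    simp [ha]
  have h1 : ∀ ω, (a - (1 / (n : ℝ)) * ∑ i, Y i ω) ^ 2 =
      (1 / (n : ℝ) ^ 2) * ((∑ i, Y i) ω - ∫ ω, (∑ i, Y i) ω ∂P) ^ 2 := by
    intro ω
    rw [hmean, Finset.sum_apply]
    field_simp
    ring
  simp_rw [h1]
  rw [integral_const_mul, ← variance_eq_integral hsum.aemeasurable,
    IndepFun.variance_sum (fun i _ => hY i) fun i _ j _ hij => hind hij]
  gcongr with i
  exact variance_le_expectation_sq (hY i).aestronglyMeasurable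

/-- The mean square error of the empirical mean of `n` independent random variables. The real and
the imaginary part are treated separately. -/
theorem integral_norm_sub_mean_sq_le {𝕜 : Type*} [RCLike 𝕜] {Ω : Type*} [MeasurableSpace Ω]
    (P : Measure Ω) [IsProbabilityMeasure P] {n : ℕ} (hn : n ≠ 0) {W : Fin n → Ω → 𝕜}
    (hW : ∀ i, MemLp (W i) 2 P) (hind : Pairwise fun i j => IndepFun (W i) (W j) P) {a : 𝕜}
    (ha : ∀ i, ∫ ω, W i ω ∂P = a) :
    ∫ ω, ‖a - (1 / (n : 𝕜)) * ∑ i, W i ω‖ ^ 2 ∂P ≤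
      (1 / (n : ℝ) ^ 2) * ∑ i, ∫ ω, ‖W i ω‖ ^ 2 ∂P := by
  have hre := integral_sub_mean_sq_le P hn (fun i => (hW i).re)
    (fun i j hij => (hind hij).comp RCLike.measurable_re RCLike.measurable_re)
    (a := RCLike.re a) fun i => by
      rw [← ha i]; exact integral_re ((hW i).integrable one_le_two)
  have him := integral_sub_mean_sq_le P hn (fun i => (hW i).im)
    (fun i j hij => (hind hij).comp RCLike.measurable_im RCLike.measurable_im)
    (a := RCLike.im a) fun i => by
      rw [← ha i]; exact integral_im ((hW i).integrable one_le_two)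
  have h1 : ∀ ω, ‖a - (1 / (n : 𝕜)) * ∑ i, W i ω‖ ^ 2 =
      (RCLike.re a - (1 / (n : ℝ)) * ∑ i, RCLike.re (W i ω)) ^ 2 +
      (RCLike.im a - (1 / (n : ℝ)) * ∑ i, RCLike.im (W i ω)) ^ 2 := by
    intro ω
    have h2 : (1 / (n : 𝕜)) = ((1 / (n : ℝ) : ℝ) : 𝕜) := by push_cast; rfl
    rw [RCLike.norm_sq_eq_def, h2, map_sub, map_sub, RCLike.re_ofReal_mul, RCLike.im_ofReal_mul,
      map_sum, map_sum, sq, sq]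
  have hire : ∀ i, Integrable (fun ω => RCLike.re (W i ω) ^ 2) P := fun i => (hW i).re.integrable_sq
  have hiim : ∀ i, Integrable (fun ω => RCLike.im (W i ω) ^ 2) P := fun i => (hW i).im.integrable_sq
  have h2 : ∀ i, ∫ ω, ‖W i ω‖ ^ 2 ∂P =
      ∫ ω, RCLike.re (W i ω) ^ 2 ∂P + ∫ ω, RCLike.im (W i ω) ^ 2 ∂P := by
    intro i
    rw [← integral_add (hire i) (hiim i)]
    refine integral_congr_ae (.of_forall fun ω => ?_)
    change ‖W i ω‖ ^ 2 = RCLike.re (W i ω) ^ 2 + RCLike.im (W i ω) ^ 2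
    rw [RCLike.norm_sq_eq_def, sq, sq]
  have h3 : MemLp (fun ω => RCLike.re a - (1 / (n : ℝ)) * ∑ i, RCLike.re (W i ω)) 2 P :=
    (memLp_const _).sub ((memLp_finsetSum _ fun i _ => (hW i).re).const_mul _)
  have h4 : MemLp (fun ω => RCLike.im a - (1 / (n : ℝ)) * ∑ i, RCLike.im (W i ω)) 2 P :=
    (memLp_const _).sub ((memLp_finsetSum _ fun i _ => (hW i).im).const_mul _)
  simp_rw [h1, h2]
  rw [integral_add h3.integrable_sq h4.integrable_sq, sum_add_distrib, mul_add]
  exact add_le_add hre him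

variable {D : Type uD} [MeasurableSpace D] {𝕜 : Type uK} [RCLike 𝕜] {μ : Measure D}
  {F : Type uF} [NormedAddCommGroup F] [InnerProductSpace 𝕜 F] [CompleteSpace F]
  {T : F →L[𝕜] Lp 𝕜 2 μ} (S : SVD T)

theorem lintegral_enorm_sq_eq {g : D → 𝕜} {h : Lp 𝕜 2 μ} (hgh : g =ᵐ[μ] h) :
    ∫⁻ x, ‖g x‖ₑ ^ 2 ∂μ = ‖h‖ₑ ^ 2 := by
  have h1 : eLpNorm g 2 μ = ‖h‖ₑ := by rw [eLpNorm_congr_ae hgh, Lp.enorm_def]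
  rw [← h1, eLpNorm_eq_lintegral_rpow_enorm_toReal two_ne_zero ENNReal.ofNat_ne_top,
    ← ENNReal.rpow_natCast, ← ENNReal.rpow_mul]
  norm_num

namespace SVD

/-- The unbiased estimate of the coefficient of `b j` of the function `g` from its value at one
point with the distribution `μ_m`. -/
noncomputable def estimate (m j : ℕ) (g : D → 𝕜) (x : D) : 𝕜 :=
  g x * (starRingEnd 𝕜) (S.fn j x) / ((S.density m x : ℝ) : 𝕜)

theorem measurable_fn (j : ℕ) : Measurable (S.fn j) := (Lp.stronglyMeasurable _).measurable

theorem measurable_density (m : ℕ) : Measurable (S.density m) := by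
  have := S.measurable_fn
  unfold density
  fun_prop

theorem density_nonneg (m : ℕ) (x : D) : 0 ≤ S.density m x := by
  unfold density
  positivity

theorem measurable_estimate (m j : ℕ) {g : D → 𝕜} (hg : Measurable g) :
    Measurable (S.estimate m j g) := by
  have h1 := S.measurable_fn j
  have h2 := S.measurable_density m
  unfold estimate
  have h3 : Measurable fun x => (starRingEnd 𝕜) (S.fn j x) :=
    RCLike.continuous_conj.measurable.comp h1
  have h4 : Measurable fun x => ((S.density m x : ℝ) : 𝕜) :=
    RCLike.continuous_ofReal.measurable.comp h2
  exact (hg.mul h3).div h4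

/-- The density `u_m` is chosen such that the second moments of the `m` estimates add up to at most
`m` times the squared norm of `g`. -/
theorem sum_norm_estimate_sq_le (m : ℕ) (g : D → 𝕜) (x : D) :
    S.density m x * ∑ j ∈ Icc 1 m, ‖S.estimate m j g x‖ ^ 2 ≤ m * ‖g x‖ ^ 2 := by
  rcases eq_or_ne m 0 with rfl | hm
  · simp
  have hm' : (m : ℝ) ≠ 0 := by exact_mod_cast hm
  by_cases hu : S.density m x = 0
  · rw [hu, zero_mul]
    positivity
  have h1 : ∑ j ∈ Icc 1 m, ‖S.fn j x‖ ^ 2 = m * S.density m x := by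
    rw [density]
    field_simp
  have h2 : ∀ j, ‖S.estimate m j g x‖ ^ 2 =
      ‖g x‖ ^ 2 / S.density m x ^ 2 * ‖S.fn j x‖ ^ 2 := by
    intro j
    simp only [estimate, norm_div, norm_mul, RCLike.norm_conj, RCLike.norm_ofReal, div_pow, mul_pow,
      sq_abs]
    ring
  simp_rw [h2]
  rw [← mul_sum, h1]
  apply le_of_eq
  field_simp

theorem lintegral_sampleMeasure (m : ℕ) {f : D → ℝ≥0∞} (hf : Measurable f) :
    ∫⁻ x, f x ∂(S.sampleMeasure m) = ∫⁻ x, ENNReal.ofReal (S.density m x) * f x ∂μ := by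
  rw [sampleMeasure,
    lintegral_withDensity_eq_lintegral_mul _ (S.measurable_density m).ennreal_ofReal hf]
  rfl

theorem sum_lintegral_estimate_sq_le (m : ℕ) {g : D → 𝕜} (hg : Measurable g) {h : Lp 𝕜 2 μ}
    (hgh : g =ᵐ[μ] h) :
    ∑ j ∈ Icc 1 m, ∫⁻ x, ‖S.estimate m j g x‖ₑ ^ 2 ∂(S.sampleMeasure m) ≤ m * ‖h‖ₑ ^ 2 := by
  have hm : ∀ j, Measurable fun x => ‖S.estimate m j g x‖ₑ ^ 2 := fun j =>
    (S.measurable_estimate m j hg).enorm.pow_const 2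
  rw [← lintegral_finsetSum _ fun j _ => hm j, S.lintegral_sampleMeasure m (by fun_prop),
    ← lintegral_enorm_sq_eq hgh, ← lintegral_const_mul' _ _ (by finiteness)]
  refine lintegral_mono fun x => ?_
  have h1 := ENNReal.ofReal_le_ofReal (S.sum_norm_estimate_sq_le m g x)
  rw [ENNReal.ofReal_mul (S.density_nonneg m x),
    ENNReal.ofReal_sum_of_nonneg (by intros; positivity),
    ENNReal.ofReal_mul (by positivity), ENNReal.ofReal_natCast] at h1
  simpa only [enorm_sq_eq_ofReal] using h1

theorem memLp_estimate {m j : ℕ} (hj : j ∈ Icc 1 m) {g : D → 𝕜} (hg : Measurable g) {h : Lp 𝕜 2 μ}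
    (hgh : g =ᵐ[μ] h) : MemLp (S.estimate m j g) 2 (S.sampleMeasure m) := by
  refine ⟨(S.measurable_estimate m j hg).aestronglyMeasurable, ?_⟩
  rw [eLpNorm_lt_top_iff_lintegral_rpow_enorm_lt_top two_ne_zero ENNReal.ofNat_ne_top]
  have h1 := (single_le_sum (f := fun j => ∫⁻ x, ‖S.estimate m j g x‖ₑ ^ 2 ∂(S.sampleMeasure m))
    (fun _ _ => zero_le) hj).trans (S.sum_lintegral_estimate_sq_le m hg hgh)
  have h2 : (m : ℝ≥0∞) * ‖h‖ₑ ^ 2 < ∞ := by finiteness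
  simpa using h1.trans_lt h2

/-- The estimates are unbiased: where the density `u_m` vanishes, so does `b j`. -/
theorem integral_estimate {m j : ℕ} (hj : j ∈ Icc 1 m) {g : D → 𝕜} {h : Lp 𝕜 2 μ}
    (hgh : g =ᵐ[μ] h) :
    ∫ x, S.estimate m j g x ∂(S.sampleMeasure m) = inner 𝕜 (T (S.b j)) h := by
  have hm := mem_Icc.1 hj
  rw [sampleMeasure, integral_withDensity_eq_integral_toReal_smul
    (S.measurable_density m).ennreal_ofReal (.of_forall fun x => ENNReal.ofReal_lt_top),
    L2.inner_def]
  refine integral_congr_ae ?_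
  filter_upwards [hgh] with x hx
  rw [ENNReal.toReal_ofReal (S.density_nonneg m x), RCLike.inner_apply, ← hx]
  change S.density m x • (g x * (starRingEnd 𝕜) (S.fn j x) / ((S.density m x : ℝ) : 𝕜)) =
    g x * (starRingEnd 𝕜) (S.fn j x)
  by_cases hu : S.density m x = 0
  · have hm' : (m : ℝ) ≠ 0 := by exact_mod_cast (by omega : m ≠ 0)
    have h1 : ∑ j ∈ Icc 1 m, ‖S.fn j x‖ ^ 2 = 0 := by
      rw [density] at hu
      field_simp at hu
      simpa using hu
    have h2 := (sum_eq_zero_iff_of_nonneg (fun _ _ => by positivity)).1 h1 j hj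
    have h3 : S.fn j x = 0 := by simpa using h2
    simp [h3]
  · have hu' : ((S.density m x : ℝ) : 𝕜) ≠ 0 := RCLike.ofReal_ne_zero.2 hu
    rw [RCLike.real_smul_eq_coe_mul]
    field_simp

/-- The mean square error of one correction step of the method. -/
theorem lintegral_step_le (hN : S.N = ⊤) {Ω : Type*} [MeasurableSpace Ω] (P : Measure Ω)
    [IsProbabilityMeasure P] {n : ℕ} (hn : n ≠ 0) (m : ℕ) {Z : Fin n → Ω → D}
    (hZ : ∀ i, Measurable (Z i)) (hlaw : ∀ i, P.map (Z i) = S.sampleMeasure m)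
    (hind : Pairwise fun i j => IndepFun (Z i) (Z j) P) {g : D → 𝕜} (hg : Measurable g)
    {h : Lp 𝕜 2 μ} (hgh : g =ᵐ[μ] h) :
    ∫⁻ ω, ‖h - ∑ j ∈ Icc 1 m, ((1 / (n : 𝕜)) * ∑ i, S.estimate m j g (Z i ω)) • T (S.b j)‖ₑ ^ 2 ∂P ≤
      ‖h - S.proj m h‖ₑ ^ 2 + (m / n : ℝ≥0∞) * ‖h‖ₑ ^ 2 := by
  have hest := fun j => S.measurable_estimate m j hg
  have h1 : ∀ ω, ‖h - ∑ j ∈ Icc 1 m,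
      ((1 / (n : 𝕜)) * ∑ i, S.estimate m j g (Z i ω)) • T (S.b j)‖ₑ ^ 2 = ‖h - S.proj m h‖ₑ ^ 2 +
      ∑ j ∈ Icc 1 m, ‖inner 𝕜 (T (S.b j)) h -
        (1 / (n : 𝕜)) * ∑ i, S.estimate m j g (Z i ω)‖ₑ ^ 2 := by
    intro ω
    simp only [enorm_sq_eq_ofReal]
    rw [S.norm_sub_sum_sq hN, ENNReal.ofReal_add (by positivity) (by positivity),
      ENNReal.ofReal_sum_of_nonneg (by intros; positivity)]
  have hmeas : ∀ j, Measurable fun ω => ‖inner 𝕜 (T (S.b j)) h -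
        (1 / (n : 𝕜)) * ∑ i, S.estimate m j g (Z i ω)‖ₑ ^ 2 := fun j =>
    (((measurable_sum _ fun i _ => (hest j).comp (hZ i)).const_mul _).const_sub _).enorm.pow_const 2
  have hcoef : ∀ j ∈ Icc 1 m, ∫⁻ ω, ‖inner 𝕜 (T (S.b j)) h -
        (1 / (n : 𝕜)) * ∑ i, S.estimate m j g (Z i ω)‖ₑ ^ 2 ∂P ≤
      (n : ℝ≥0∞)⁻¹ * ∫⁻ x, ‖S.estimate m j g x‖ₑ ^ 2 ∂(S.sampleMeasure m) := by
    intro j hj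
    have hL := S.memLp_estimate hj hg hgh
    have hW : ∀ i, MemLp (fun ω => S.estimate m j g (Z i ω)) 2 P := fun i =>
      (memLp_map_measure_iff (hest j).aestronglyMeasurable (hZ i).aemeasurable).1
        (by rwa [hlaw i])
    have hmean : ∀ i, ∫ ω, S.estimate m j g (Z i ω) ∂P = inner 𝕜 (T (S.b j)) h := fun i => by
      rw [← S.integral_estimate hj hgh, ← hlaw i,
        integral_map (hZ i).aemeasurable (hest j).aestronglyMeasurable]
    have hsq : ∀ i, ∫ ω, ‖S.estimate m j g (Z i ω)‖ ^ 2 ∂P =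
        ∫ x, ‖S.estimate m j g x‖ ^ 2 ∂(S.sampleMeasure m) := fun i => by
      rw [← hlaw i, integral_map (hZ i).aemeasurable
        ((hest j).norm.pow_const 2).aestronglyMeasurable]
    have hv := integral_norm_sub_mean_sq_le P hn hW
      (fun i k hik => (hind hik).comp (hest j) (hest j)) hmean
    simp only [hsq, sum_const, card_univ, Fintype.card_fin, nsmul_eq_mul] at hv
    have hn' : (n : ℝ) ≠ 0 := by exact_mod_cast hn
    have hv' : ∫ ω, ‖inner 𝕜 (T (S.b j)) h -
        (1 / (n : 𝕜)) * ∑ i, S.estimate m j g (Z i ω)‖ ^ 2 ∂P ≤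
        (n : ℝ)⁻¹ * ∫ x, ‖S.estimate m j g x‖ ^ 2 ∂(S.sampleMeasure m) := by
      refine hv.trans (le_of_eq ?_)
      field_simp
    have hI : MemLp (fun ω => inner 𝕜 (T (S.b j)) h -
        (1 / (n : 𝕜)) * ∑ i, S.estimate m j g (Z i ω)) 2 P :=
      (memLp_const _).sub ((memLp_finsetSum _ fun i _ => hW i).const_mul _)
    simp only [enorm_sq_eq_ofReal]
    rw [← ofReal_integral_eq_lintegral_ofReal hI.norm.integrable_sq
        (.of_forall fun _ => by positivity),
      ← ofReal_integral_eq_lintegral_ofReal hL.norm.integrable_sq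
        (.of_forall fun _ => by positivity),
      ← ENNReal.ofReal_natCast, ← ENNReal.ofReal_inv_of_pos (by positivity),
      ← ENNReal.ofReal_mul (by positivity)]
    exact ENNReal.ofReal_le_ofReal hv'
  simp_rw [h1]
  rw [lintegral_add_left measurable_const, lintegral_const, measure_univ, mul_one,
    lintegral_finsetSum _ fun j _ => hmeas j]
  gcongr
  calc _ ≤ ∑ j ∈ Icc 1 m, (n : ℝ≥0∞)⁻¹ * ∫⁻ x, ‖S.estimate m j g x‖ₑ ^ 2 ∂(S.sampleMeasure m) :=
        sum_le_sum hcoef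
    _ ≤ (n : ℝ≥0∞)⁻¹ * (m * ‖h‖ₑ ^ 2) := by
        rw [← mul_sum]
        exact mul_le_mul_right (S.sum_lintegral_estimate_sq_le m hg hgh) _
    _ = _ := by rw [div_eq_mul_inv, ← mul_assoc, mul_comm (m : ℝ≥0∞)]

end SVD

end OneStep

/-! ### The approximations as functions of the nodes -/

section Trees

/-- A map that depends only on the values of the unknown function at `n` fixed points is computed
by a nonadaptive algorithm. -/
theorem exists_samplingTree {D 𝕜 G : Type*} [Nonempty 𝕜] {n : ℕ} (s : Finset D) (hs : #s ≤ n)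
    (Φ : (D → 𝕜) → G) (hΦ : ∀ g g' : D → 𝕜, (∀ x ∈ s, g x = g' x) → Φ g = Φ g') :
    ∃ t : SamplingTree D 𝕜 G n, ∀ g, Φ g = t.eval g := by
  classical
  induction s using Finset.induction_on generalizing n Φ with
  | empty => exact
    ⟨.output (Φ fun _ => Classical.arbitrary 𝕜), fun g => hΦ g _ (by simp)⟩
  | insert x s hx ih =>
    rw [card_insert_of_notMem hx] at hs
    obtain ⟨n, rfl⟩ := Nat.exists_eq_add_of_le' hs
    choose next hnext using fun y : 𝕜 => ih (n := n + #s) (by omega)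
      (fun g => Φ (Function.update g x y)) fun g g' h => hΦ _ _ fun z hz => by
        by_cases hzx : z = x
        · simp [hzx]
        · simp [hzx, h z ((mem_insert.1 hz).resolve_left hzx)]
    refine ⟨.sample x next, fun g => ?_⟩
    rw [SamplingTree.eval, ← hnext, Function.update_eq_self]

end Trees

section Coefficients

theorem lintegral_comp_of_indepFun {Ω E E' : Type*} [MeasurableSpace Ω] [MeasurableSpace E]
    [MeasurableSpace E'] {P : Measure Ω} [IsProbabilityMeasure P] {Y : Ω → E} {Z : Ω → E'}
    (hY : Measurable Y) (hZ : Measurable Z) (h : IndepFun Y Z P) {f : E × E' → ℝ≥0∞}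
    (hf : Measurable f) :
    ∫⁻ ω, f (Y ω, Z ω) ∂P = ∫⁻ ω', ∫⁻ ω, f (Y ω', Z ω) ∂P ∂P := by
  have := Measure.isProbabilityMeasure_map (μ := P) hY.aemeasurable
  have := Measure.isProbabilityMeasure_map (μ := P) hZ.aemeasurable
  have h1 := (indepFun_iff_map_prod_eq_prod_map_map hY.aemeasurable hZ.aemeasurable).1 h
  rw [← lintegral_map hf (hY.prodMk hZ), h1, lintegral_prod _ hf.aemeasurable,
    lintegral_map (by exact hf.lintegral_prod_right') hY]
  refine lintegral_congr fun ω' => ?_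
  rw [lintegral_map (by fun_prop) hZ]

variable {D : Type uD} [MeasurableSpace D] {𝕜 : Type uK} [RCLike 𝕜] {μ : Measure D}
  {F : Type uF} [NormedAddCommGroup F] [InnerProductSpace 𝕜 F] [CompleteSpace F]
  {T : F →L[𝕜] Lp 𝕜 2 μ} (S : SVD T)

theorem measurable_borel_sum_smul {X E : Type*} [MeasurableSpace X] [NormedAddCommGroup E]
    [NormedSpace 𝕜 E] (s : Finset ℕ) {c : X → ℕ → 𝕜} (hc : ∀ j, Measurable fun x => c x j)
    (e : ℕ → E) : Measurable[inferInstance, borel E] fun x => ∑ j ∈ s, c x j • e j := by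
  borelize E
  have h1 : Continuous fun a : s → 𝕜 => ∑ j : s, a j • e j := by fun_prop
  have h2 : Measurable fun x => fun j : s => c x j := measurable_pi_lambda _ fun j => hc j
  have h3 : (fun x => ∑ j ∈ s, c x j • e j) =
      (fun a : s → 𝕜 => ∑ j : s, a j • e j) ∘ fun x => fun j : s => c x j := by
    ext x
    exact (sum_coe_sort s fun j => c x j • e j).symm
  rw [h3]
  exact h1.measurable.comp h2

theorem measurable_enorm_sub_sum_smul {X E : Type*} [MeasurableSpace X] [NormedAddCommGroup E]
    [NormedSpace 𝕜 E] (s : Finset ℕ) {c : X → ℕ → 𝕜} (hc : ∀ j, Measurable fun x => c x j)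
    (e : ℕ → E) (h : E) : Measurable fun x => ‖h - ∑ j ∈ s, c x j • e j‖ₑ ^ 2 := by
  have h1 := measurable_borel_sum_smul s hc e
  borelize E
  have h2 : Continuous fun y : E => ‖h - y‖ₑ ^ 2 := by fun_prop
  exact h2.measurable.comp h1

namespace SVD

/-- The coefficient of `b j` in the `k`-th approximation of `g` for the nodes `x`. -/
noncomputable def coef (n m : ℕ → ℕ) (x : (j : ℕ) → Fin (n j) → D) :
    ℕ → (D → 𝕜) → ℕ → 𝕜
  | 0, _, _ => 0
  | k + 1, g, j => coef n m x k g j + if j ∈ Icc 1 (m (k + 1)) then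
      (1 / (n (k + 1) : 𝕜)) * ∑ i, S.estimate (m (k + 1)) j (g - S.method n m x k g) (x (k + 1) i)
      else 0

/-- The `k`-th approximation of `g` for the nodes `x`, as an element of `L²`. -/
noncomputable def approx (n m : ℕ → ℕ) (x : (j : ℕ) → Fin (n j) → D) (k : ℕ) (g : D → 𝕜) :
    Lp 𝕜 2 μ :=
  ∑ j ∈ Icc 1 (m k), S.coef n m x k g j • T (S.b j)

variable {n m : ℕ → ℕ}

theorem coef_eq_zero (hm : Monotone m) (x : (j : ℕ) → Fin (n j) → D) (k : ℕ) (g : D → 𝕜) {j : ℕ}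
    (hj : j ∉ Icc 1 (m k)) : S.coef n m x k g j = 0 := by
  induction k with
  | zero => rfl
  | succ k ih =>
    rw [coef, if_neg hj, add_zero]
    exact ih fun h => hj (Icc_subset_Icc_right (hm k.le_succ) h)

theorem method_eq_sum (hm : Monotone m) (x : (j : ℕ) → Fin (n j) → D) (k : ℕ) (g : D → 𝕜) :
    S.method n m x k g = fun y => ∑ j ∈ Icc 1 (m k), S.coef n m x k g j * S.fn j y := by
  induction k with
  | zero => ext y; simp [method, coef]
  | succ k ih =>
    ext y
    simp only [coef, add_mul, sum_add_distrib]
    rw [← sum_subset (Icc_subset_Icc_right (hm k.le_succ)) fun j _ hj => by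
      rw [S.coef_eq_zero hm x k g hj, zero_mul]]
    refine congrArg₂ (· + ·) (congrFun ih y) (sum_congr rfl fun j hj => ?_)
    rw [if_pos hj]
    rfl

theorem toLp_method (hm : Monotone m) (x : (j : ℕ) → Fin (n j) → D) (k : ℕ) (g : D → 𝕜) :
    (S.memLp_method n m x k g).toLp = S.approx n m x k g := by
  refine Lp.ext ((MemLp.coeFn_toLp _).trans ?_)
  rw [approx, S.method_eq_sum hm]
  refine Filter.EventuallyEq.trans ?_ (Lp.coeFn_finsetSum _ _).symm
  have h1 : ∀ j, ⇑(S.coef n m x k g j • T (S.b j)) =ᵐ[μ] S.coef n m x k g j • ⇑(T (S.b j)) :=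
    fun j => Lp.coeFn_smul _ _
  filter_upwards [eventually_countable_forall.2 h1] with y hy
  simp only [Finset.sum_apply, hy]
  rfl

theorem method_ae_eq_approx (hm : Monotone m) (x : (j : ℕ) → Fin (n j) → D) (k : ℕ) (g : D → 𝕜) :
    S.method n m x k g =ᵐ[μ] S.approx n m x k g := by
  rw [← S.toLp_method hm]
  exact (MemLp.coeFn_toLp _).symm

theorem approx_succ (hm : Monotone m) (x : (j : ℕ) → Fin (n j) → D) (k : ℕ) (g : D → 𝕜) :
    S.approx n m x (k + 1) g = S.approx n m x k g + ∑ j ∈ Icc 1 (m (k + 1)),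
      ((1 / (n (k + 1) : 𝕜)) * ∑ i, S.estimate (m (k + 1)) j (g - S.method n m x k g)
        (x (k + 1) i)) • T (S.b j) := by
  simp only [approx, coef, add_smul, sum_add_distrib]
  rw [← sum_subset (Icc_subset_Icc_right (hm k.le_succ)) fun j _ hj => by
    rw [S.coef_eq_zero hm x k g hj, zero_smul]]
  congr 1
  refine sum_congr rfl fun j hj => ?_
  rw [if_pos hj]

theorem proj_approx (hN : S.N = ⊤) (x : (j : ℕ) → Fin (n j) → D) (k : ℕ) (g : D → 𝕜) {M : ℕ}
    (hM : m k ≤ M) : S.proj M (S.approx n m x k g) = S.approx n m x k g :=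
  S.proj_sum_smul hN hM _

/-- The `k`-th approximation depends on the nodes with index at most `k` only. -/
theorem method_congr_nodes {x x' : (j : ℕ) → Fin (n j) → D} {k : ℕ}
    (hx : ∀ j, j ≤ k → x j = x' j) (g : D → 𝕜) : S.method n m x k g = S.method n m x' k g := by
  induction k with
  | zero => rfl
  | succ k ih =>
    ext y
    rw [method, method, ih fun j hj => hx j (by omega), hx (k + 1) le_rfl]

/-- The `k`-th approximation depends on the function values at the nodes with index at most `k`
only. -/
theorem method_congr_values {x : (j : ℕ) → Fin (n j) → D} {k : ℕ} {g g' : D → 𝕜}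
    (hg : ∀ j i, j ≤ k → g (x j i) = g' (x j i)) : S.method n m x k g = S.method n m x k g' := by
  induction k with
  | zero => rfl
  | succ k ih =>
    ext y
    rw [method, method, ih fun j i hj => hg j i (by omega)]
    simp only [hg (k + 1) _ le_rfl]

theorem method_add (x : (j : ℕ) → Fin (n j) → D) (k : ℕ) (g g' : D → 𝕜) :
    S.method n m x k (g + g') = S.method n m x k g + S.method n m x k g' := by
  induction k with
  | zero => simp [method]
  | succ k ih =>
    ext y
    have h1 : ∀ a b c d e f : 𝕜, (a + b - (c + d)) * e / f = (a - c) * e / f + (b - d) * e / f := by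
      intros; ring
    simp only [method, ih, Pi.add_apply, h1, sum_add_distrib, mul_add, add_mul]
    ring

theorem method_smul (x : (j : ℕ) → Fin (n j) → D) (k : ℕ) (c : 𝕜) (g : D → 𝕜) :
    S.method n m x k (c • g) = c • S.method n m x k g := by
  induction k with
  | zero => simp [method]
  | succ k ih =>
    ext y
    have h1 : ∀ a b e f : 𝕜, (c * a - c * b) * e / f = c * ((a - b) * e / f) := by
      intros; ring
    simp only [method, ih, Pi.smul_apply, smul_eq_mul, h1, ← mul_sum, mul_add]
    congr 1
    rw [mul_sum]
    refine sum_congr rfl fun j _ => ?_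
    ring

theorem coef_add (x : (j : ℕ) → Fin (n j) → D) (k : ℕ) (g g' : D → 𝕜) (j : ℕ) :
    S.coef n m x k (g + g') j = S.coef n m x k g j + S.coef n m x k g' j := by
  induction k with
  | zero => simp [coef]
  | succ k ih =>
    have h1 : ∀ a b c d e f : 𝕜, (a + b - (c + d)) * e / f = (a - c) * e / f + (b - d) * e / f := by
      intros; ring
    simp only [coef, ih, estimate, S.method_add, Pi.add_apply, Pi.sub_apply, h1, sum_add_distrib,
      mul_add]
    split_ifs <;> ring

theorem coef_smul (x : (j : ℕ) → Fin (n j) → D) (k : ℕ) (c : 𝕜) (g : D → 𝕜) (j : ℕ) :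
    S.coef n m x k (c • g) j = c * S.coef n m x k g j := by
  induction k with
  | zero => simp [coef]
  | succ k ih =>
    have h1 : ∀ a b e f : 𝕜, (c * a - c * b) * e / f = c * ((a - b) * e / f) := by
      intros; ring
    simp only [coef, ih, estimate, S.method_smul, Pi.smul_apply, Pi.sub_apply, smul_eq_mul, h1,
      ← mul_sum]
    split_ifs <;> ring

theorem coef_sum_smul (x : (j : ℕ) → Fin (n j) → D) (k : ℕ) {d : ℕ} (c : Fin d → 𝕜)
    (v : Fin d → D → 𝕜) (j : ℕ) :
    S.coef n m x k (∑ i, c i • v i) j = ∑ i, c i * S.coef n m x k (v i) j := by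
  let l : (D → 𝕜) →ₗ[𝕜] 𝕜 :=
    { toFun := fun g => S.coef n m x k g j
      map_add' := fun g g' => S.coef_add x k g g' j
      map_smul' := fun c g => S.coef_smul x k c g j }
  have h := map_sum l (fun i => c i • v i) univ
  exact h.trans (sum_congr rfl fun i _ => S.coef_smul x k (c i) (v i) j)

theorem measurable_residual {ι : Type*} [MeasurableSpace ι] {X : ι → (j : ℕ) → Fin (n j) → D}
    (hm : Monotone m) {k : ℕ} {g : D → 𝕜} (hg : Measurable g)
    (hc : ∀ j, Measurable fun x => S.coef n m (X x) k g j) {z : ι → D} (hz : Measurable z)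
    (M j : ℕ) :
    Measurable fun x => S.estimate M j (g - S.method n m (X x) k g) (z x) := by
  have h1 : ∀ j, Measurable fun x => S.fn j (z x) := fun j => (S.measurable_fn j).comp hz
  have h2 : Measurable fun x => ((S.density M (z x) : ℝ) : 𝕜) :=
    RCLike.continuous_ofReal.measurable.comp ((S.measurable_density M).comp hz)
  have h3 : Measurable fun x => (starRingEnd 𝕜) (S.fn j (z x)) :=
    RCLike.continuous_conj.measurable.comp (h1 j)
  simp only [estimate, Pi.sub_apply, S.method_eq_sum hm]
  exact (((hg.comp hz).sub (measurable_sum _ fun j _ => (hc j).mul (h1 j))).mul h3).div h2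

theorem measurable_coef (hm : Monotone m) (k : ℕ) {g : D → 𝕜} (hg : Measurable g) (j : ℕ) :
    Measurable fun x : (j : ℕ) → Fin (n j) → D => S.coef n m x k g j := by
  induction k generalizing j with
  | zero => exact measurable_const
  | succ k ih =>
    simp only [coef]
    refine (ih j).add ?_
    split_ifs with h
    · exact (measurable_sum _ fun i _ => S.measurable_residual (X := id) hm hg ih
        (by fun_prop) _ _).const_mul _
    · exact measurable_const

theorem measurable_method (hm : Monotone m) (x : (j : ℕ) → Fin (n j) → D) (k : ℕ) (g : D → 𝕜) :
    Measurable (S.method n m x k g) := by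
  rw [S.method_eq_sum hm]
  exact measurable_sum _ fun j _ => (S.measurable_fn j).const_mul _

/-- One step of the method reduces the error: the nodes of the step are independent of those that
were used before. -/
theorem lintegral_approx_succ_le (hN : S.N = ⊤) (hm : Monotone m) {Ω : Type uΩ} [MeasurableSpace Ω]
    (P : Measure Ω) [IsProbabilityMeasure P] {X : (j : ℕ) → Fin (n j) → Ω → D}
    (hX : S.IsNodes P n m X) {k : ℕ} (hn : n (k + 1) ≠ 0) {g : D → 𝕜} (hg : Measurable g) {f : F}
    (hgf : g =ᵐ[μ] T f) :
    ∫⁻ ω, ‖T f - S.approx n m (fun j i => X j i ω) (k + 1) g‖ₑ ^ 2 ∂P ≤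
      ‖T f - S.proj (m (k + 1)) (T f)‖ₑ ^ 2 + (m (k + 1) / n (k + 1) : ℝ≥0∞) *
        ∫⁻ ω, ‖T f - S.approx n m (fun j i => X j i ω) k g‖ₑ ^ 2 ∂P := by
  obtain ⟨ω₀⟩ : Nonempty Ω := nonempty_of_isProbabilityMeasure P
  -- The earlier nodes, where the later ones are frozen.
  let Y : Ω → (j : ℕ) → Fin (n j) → D := fun ω j i => if j ≤ k then X j i ω else X j i ω₀
  let Z : Ω → Fin (n (k + 1)) → D := fun ω i => X (k + 1) i ω
  have hYm : Measurable Y := by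
    refine measurable_pi_lambda _ fun j => measurable_pi_lambda _ fun i => ?_
    by_cases hj : j ≤ k
    · simpa [Y, hj] using hX.measurable j i
    · simp [Y, hj]
  have hZm : Measurable Z := measurable_pi_lambda _ fun i => hX.measurable _ i
  have hYZ : IndepFun Y Z P := by
    let A : Finset ((j : ℕ) × Fin (n j)) := (range (k + 1)).sigma fun _ => univ
    let B : Finset ((j : ℕ) × Fin (n j)) := ({k + 1} : Finset ℕ).sigma fun _ => univ
    have hAB : Disjoint A B := by
      rw [Finset.disjoint_left]
      rintro ⟨j, i⟩ h1 h2
      simp [A, B] at h1 h2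
      omega
    have h1 := hX.indep.indepFun_finset A B hAB fun p => hX.measurable p.1 p.2
    let ψ : (A → D) → (j : ℕ) → Fin (n j) → D := fun y j i =>
      if h : j ≤ k then y ⟨⟨j, i⟩, by simp [A]; omega⟩ else X j i ω₀
    let χ : (B → D) → Fin (n (k + 1)) → D := fun z i => z ⟨⟨k + 1, i⟩, by simp [B]⟩
    have hψ : Measurable ψ := by
      refine measurable_pi_lambda _ fun j => measurable_pi_lambda _ fun i => ?_
      by_cases hj : j ≤ k
      · simp only [ψ, hj, dite_true]
        exact measurable_pi_apply _
      · simp [ψ, hj]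
    have hχ : Measurable χ := measurable_pi_lambda _ fun i => measurable_pi_apply _
    exact h1.comp hψ hχ
  have hYX : ∀ ω, S.method n m (fun j i => X j i ω) k g = S.method n m (Y ω) k g := fun ω =>
    S.method_congr_nodes (fun j hj => by ext i; simp [Y, hj]) g
  have happ : ∀ ω, S.approx n m (fun j i => X j i ω) k g = S.approx n m (Y ω) k g := fun ω => by
    rw [← S.toLp_method hm, ← S.toLp_method hm]
    simp only [hYX]
  let Q : ((j : ℕ) → Fin (n j) → D) × (Fin (n (k + 1)) → D) → ℕ → 𝕜 := fun p j =>
    (1 / (n (k + 1) : 𝕜)) * ∑ i, S.estimate (m (k + 1)) j (g - S.method n m p.1 k g) (p.2 i)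
  have hcm : ∀ j, Measurable fun p : ((j : ℕ) → Fin (n j) → D) × (Fin (n (k + 1)) → D) =>
      S.coef n m p.1 k g j := fun j => (S.measurable_coef hm k hg j).comp measurable_fst
  have hQ : ∀ j, Measurable fun p => Q p j := fun j =>
    (measurable_sum _ fun i _ => S.measurable_residual (X := Prod.fst) hm hg hcm
      ((measurable_pi_apply i).comp measurable_snd) _ _).const_mul _
  let R : ((j : ℕ) → Fin (n j) → D) × (Fin (n (k + 1)) → D) → ℝ≥0∞ := fun p =>
    ‖T f - S.approx n m p.1 k g - ∑ j ∈ Icc 1 (m (k + 1)), Q p j • T (S.b j)‖ₑ ^ 2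
  have hR : Measurable R := by
    have h1 : R = fun p => ‖T f - ∑ j ∈ Icc 1 (m (k + 1)),
        (S.coef n m p.1 k g j + Q p j) • T (S.b j)‖ₑ ^ 2 := by
      ext p
      have h2 : S.approx n m p.1 k g =
          ∑ j ∈ Icc 1 (m (k + 1)), S.coef n m p.1 k g j • T (S.b j) :=
        sum_subset (Icc_subset_Icc_right (hm k.le_succ)) fun j _ hj => by
          rw [S.coef_eq_zero hm p.1 k g hj, zero_smul]
      simp only [R, h2, add_smul, sum_add_distrib, sub_sub]
    rw [h1]
    exact measurable_enorm_sub_sum_smul _ (fun j => (hcm j).add (hQ j)) _ _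
  calc ∫⁻ ω, ‖T f - S.approx n m (fun j i => X j i ω) (k + 1) g‖ₑ ^ 2 ∂P
      = ∫⁻ ω, R (Y ω, Z ω) ∂P := by
        refine lintegral_congr fun ω => ?_
        rw [S.approx_succ hm, ← sub_sub, happ, hYX]
    _ = ∫⁻ ω', ∫⁻ ω, R (Y ω', Z ω) ∂P ∂P := lintegral_comp_of_indepFun hYm hZm hYZ hR
    _ ≤ ∫⁻ ω', ‖T f - S.proj (m (k + 1)) (T f)‖ₑ ^ 2 + (m (k + 1) / n (k + 1) : ℝ≥0∞) *
          ‖T f - S.approx n m (Y ω') k g‖ₑ ^ 2 ∂P := by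
        refine lintegral_mono fun ω' => ?_
        have h1 := S.lintegral_step_le hN P hn (m (k + 1)) (Z := X (k + 1))
          (fun i => hX.measurable _ i) (fun i => hX.law _ i)
          (fun i i' hi => hX.indep.indepFun (i := ⟨k + 1, i⟩) (j := ⟨k + 1, i'⟩)
            (by simpa using hi))
          (hg.sub (S.measurable_method hm (Y ω') k g))
          (h := T f - S.approx n m (Y ω') k g)
          ((hgf.sub (S.method_ae_eq_approx hm (Y ω') k g)).trans (Lp.coeFn_sub _ _).symm)
        rw [S.proj_sub, S.proj_approx hN _ _ _ (hm k.le_succ), sub_sub_sub_cancel_right] at h1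
        exact h1
    _ = _ := by
        rw [lintegral_add_left measurable_const, lintegral_const, measure_univ, mul_one]
        simp only [happ]
        rw [lintegral_const_mul]
        exact (measurable_enorm_sub_sum_smul _ (fun j => S.measurable_coef hm k hg j) _ _).comp hYm

end SVD

end Coefficients

/-! ### The error of the algorithm -/

section Algorithm

variable {D : Type uD} [MeasurableSpace D] {𝕜 : Type uK} [RCLike 𝕜] {μ : Measure D}
  {F : Type uF} [NormedAddCommGroup F] [InnerProductSpace 𝕜 F] [CompleteSpace F]
  {T : F →L[𝕜] Lp 𝕜 2 μ} (S : SVD T)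

namespace SVD

theorem coeffCount_of_top (hN : S.N = ⊤) (r : ℝ) (j : ℕ) :
    S.coeffCount r j = if j ≤ ell r then 0 else 2 ^ (j - 1 - ell r) := by
  rw [coeffCount, hN, min_eq_left le_top, ENat.toNat_natCast]

theorem coeffCount_of_zero (hN : S.N = 0) (r : ℝ) (j : ℕ) : S.coeffCount r j = 0 := by
  simp [coeffCount, hN]

theorem monotone_coeffCount (hN : S.N = ⊤) (r : ℝ) : Monotone (S.coeffCount r) := by
  intro j k hjk
  rw [S.coeffCount_of_top hN, S.coeffCount_of_top hN]
  split_ifs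
  · exact le_rfl
  · exact Nat.zero_le _
  · omega
  · exact Nat.pow_le_pow_right (by omega) (by omega)

theorem sum_nodeCount_add_one_le (r : ℝ) (k : ℕ) :
    ∑ j ∈ range (k + 1), nodeCount r j + 1 ≤ 2 ^ k := by
  induction k with
  | zero => simp [nodeCount]
  | succ k ih =>
    rw [sum_range_succ, pow_succ]
    have h : nodeCount r (k + 1) ≤ 2 ^ k := by
      rw [nodeCount]
      split_ifs <;> simp
    omega

theorem algorithm_eq_approx {r : ℝ} (hm : Monotone (S.coeffCount r)) {Ω : Type uΩ}
    [MeasurableSpace Ω] (X : (j : ℕ) → Fin (nodeCount r j) → Ω → D) (n : ℕ) (ω : Ω) (g : D → 𝕜) :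
    S.algorithm r X n ω g =
      S.approx (nodeCount r) (S.coeffCount r) (fun j i => X j i ω) (Nat.log 2 n) g :=
  S.toLp_method hm _ _ _

theorem isStdAlgorithm {V : Submodule 𝕜 (D → 𝕜)} (hV : IsFunctionSpace T V) {r : ℝ}
    (hm : Monotone (S.coeffCount r)) {Ω : Type uΩ} [MeasurableSpace Ω]
    {X : (j : ℕ) → Fin (nodeCount r j) → Ω → D} (hX : ∀ j i, Measurable (X j i)) {n : ℕ}
    (hn : 1 ≤ n) : IsStdAlgorithm V n (S.algorithm r X n) := by
  classical
  refine ⟨fun ω => ?_, fun d v hv => ?_⟩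
  · let s : Finset D := ((range (Nat.log 2 n + 1)).sigma fun j =>
      (univ : Finset (Fin (nodeCount r j)))).image fun p => X p.1 p.2 ω
    have hs : #s ≤ n := by
      refine card_image_le.trans ?_
      rw [card_sigma]
      simp only [card_univ, Fintype.card_fin]
      have h1 := sum_nodeCount_add_one_le r (Nat.log 2 n)
      have h2 := Nat.pow_log_le_self 2 (x := n) (by omega)
      omega
    obtain ⟨t, ht⟩ := exists_samplingTree s hs (S.algorithm r X n ω) fun g g' h => by
      have h1 : S.method (nodeCount r) (S.coeffCount r) (fun j i => X j i ω) (Nat.log 2 n) g =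
          S.method (nodeCount r) (S.coeffCount r) (fun j i => X j i ω) (Nat.log 2 n) g' :=
        S.method_congr_values fun j i hj => h _ (mem_image.2 ⟨⟨j, i⟩, by simp; omega, rfl⟩)
      simp only [algorithm, h1]
    exact ⟨t, fun g _ => ht g⟩
  · simp only [S.algorithm_eq_approx hm, approx]
    refine measurable_borel_sum_smul _ (fun j => ?_) _
    simp only [S.coef_sum_smul]
    have hXm : Measurable fun ω => fun j i => X j i ω :=
      measurable_pi_lambda _ fun j => measurable_pi_lambda _ fun i => hX j i
    exact measurable_sum _ fun i _ => ((measurable_pi_apply i).comp measurable_fst).mul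
      (((S.measurable_coef hm _ (hV.measurable _ (hv i)) j).comp hXm).comp measurable_snd)

theorem sigma_pow_le {r : ℝ} (hσ : ∀ n : ℕ, 1 ≤ n → S.sigma (2 * n) ≥ (2 : ℝ) ^ (-r) * S.sigma n)
    (p q : ℕ) : (2 : ℝ) ^ (-(r * q)) * S.sigma (2 ^ p) ≤ S.sigma (2 ^ (p + q)) := by
  induction q with
  | zero => simp
  | succ q ih =>
    have h1 := hσ (2 ^ (p + q)) Nat.one_le_two_pow
    rw [← add_assoc, pow_succ', Nat.cast_succ,
      show -(r * ((q : ℝ) + 1)) = -r + -(r * q) by ring, Real.rpow_add two_pos, mul_assoc]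
    exact (mul_le_mul_of_nonneg_left ih (by positivity)).trans h1

theorem lintegral_approx_succ_le_ofReal (hN : S.N = ⊤) {n m : ℕ → ℕ} (hm : Monotone m) {Ω : Type uΩ}
    [MeasurableSpace Ω] (P : Measure Ω) [IsProbabilityMeasure P] {X : (j : ℕ) → Fin (n j) → Ω → D}
    (hX : S.IsNodes P n m X) {k : ℕ} (hn : n (k + 1) ≠ 0) {g : D → 𝕜} (hg : Measurable g) {f : F}
    (hf : ‖f‖ ≤ 1) (hgf : g =ᵐ[μ] T f) {a : ℝ}
    (hE : ∫⁻ ω, ‖T f - S.approx n m (fun j i => X j i ω) k g‖ₑ ^ 2 ∂P ≤ ENNReal.ofReal a) :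
    ∫⁻ ω, ‖T f - S.approx n m (fun j i => X j i ω) (k + 1) g‖ₑ ^ 2 ∂P ≤
      ENNReal.ofReal (S.eig (m (k + 1) + 1)) + ENNReal.ofReal (m (k + 1) / n (k + 1) * a) := by
  refine (S.lintegral_approx_succ_le hN hm P hX hn hg hgf).trans (add_le_add ?_ ?_)
  · rw [enorm_sq_eq_ofReal]
    refine ENNReal.ofReal_le_ofReal ((S.norm_sub_proj_sq_le hN _ f).trans ?_)
    exact mul_le_of_le_one_right (S.eig_nonneg (by omega))
      ((sq_le_one_iff₀ (norm_nonneg f)).2 hf)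
  · rw [ENNReal.ofReal_mul (by positivity), ENNReal.ofReal_div_of_pos (by positivity),
      ENNReal.ofReal_natCast, ENNReal.ofReal_natCast]
    exact mul_le_mul_right hE _

/-- The upper bound for the error of the algorithm: from the index `ℓ_r + 1` on, the mean square
error is at most twice the square of the singular value `σ(2^i)`. One step contributes the square
of the next singular value and `2^(-ℓ_r)` times the previous error; the choice `ℓ_r ≥ 2r + 1` makes
the latter no larger than the former. -/
theorem lintegral_algorithm_le (hN : S.N = ⊤) {r : ℝ}
    (hσ : ∀ n : ℕ, 1 ≤ n → S.sigma (2 * n) ≥ (2 : ℝ) ^ (-r) * S.sigma n) {Ω : Type uΩ}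
    [MeasurableSpace Ω] (P : Measure Ω) [IsProbabilityMeasure P]
    {X : (j : ℕ) → Fin (nodeCount r j) → Ω → D}
    (hX : S.IsNodes P (nodeCount r) (S.coeffCount r) X) {g : D → 𝕜} (hg : Measurable g) {f : F}
    (hf : ‖f‖ ≤ 1) (hgf : g =ᵐ[μ] T f) (i : ℕ) :
    ∫⁻ ω, ‖T f - S.approx (nodeCount r) (S.coeffCount r) (fun j i => X j i ω)
      (ell r + i + 1) g‖ₑ ^ 2 ∂P ≤ ENNReal.ofReal (2 * S.eig (2 ^ i)) := by
  have hm := S.monotone_coeffCount hN r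
  have hmi : ∀ i, S.coeffCount r (ell r + i + 1) = 2 ^ i := fun i => by
    rw [S.coeffCount_of_top hN, if_neg (by omega)]
    congr 1
    omega
  have hni : ∀ i, nodeCount r (ell r + i + 1) = 2 ^ (ell r + i) := fun i => by
    rw [nodeCount, if_neg (by omega)]
    congr 1
  induction i with
  | zero =>
    have h0 : ∀ x, S.approx (nodeCount r) (S.coeffCount r) x (ell r + 0) g = 0 := fun x => by
      rw [approx, S.coeffCount_of_top hN, if_pos (by omega)]
      simp
    have h1 : ∫⁻ ω, ‖T f - S.approx (nodeCount r) (S.coeffCount r) (fun j i => X j i ω)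
        (ell r + 0) g‖ₑ ^ 2 ∂P ≤ ENNReal.ofReal (S.eig 1) := by
      simp only [h0, sub_zero, lintegral_const, measure_univ, mul_one]
      rw [enorm_sq_eq_ofReal]
      refine ENNReal.ofReal_le_ofReal ((S.norm_T_sq_le hN f).trans ?_)
      exact mul_le_of_le_one_right (S.eig_nonneg le_rfl) ((sq_le_one_iff₀ (norm_nonneg f)).2 hf)
    refine (S.lintegral_approx_succ_le_ofReal hN hm P hX (k := ell r + 0)
      (by rw [hni 0]; simp) hg hf hgf h1).trans ?_
    have he := S.eig_nonneg le_rfl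
    rw [← ENNReal.ofReal_add (S.eig_nonneg (Nat.le_add_left 1 _)) (by positivity),
      hmi 0, hni 0]
    refine ENNReal.ofReal_le_ofReal ?_
    have h2 := S.antitone 1 (2 ^ 0 + 1) le_rfl (by omega)
    have h3 : (((2 ^ 0 : ℕ) : ℝ) / ((2 ^ (ell r + 0) : ℕ) : ℝ)) * S.eig 1 ≤ S.eig 1 := by
      refine mul_le_of_le_one_left he ?_
      rw [div_le_one (by positivity)]
      exact_mod_cast Nat.pow_le_pow_right (by omega) (by omega)
    rw [pow_zero] at *
    linarith
  | succ i ih =>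
    have h1 := S.lintegral_approx_succ_le_ofReal hN hm P hX (k := ell r + i + 1)
      (by rw [show ell r + i + 1 + 1 = ell r + (i + 1) + 1 by ring, hni]; simp) hg hf hgf ih
    rw [show ell r + i + 1 + 1 = ell r + (i + 1) + 1 by ring, hmi, hni] at h1
    refine h1.trans ?_
    have he := S.eig_nonneg (k := 2 ^ i) Nat.one_le_two_pow
    have he' := S.eig_nonneg (k := 2 ^ (i + 1)) Nat.one_le_two_pow
    rw [← ENNReal.ofReal_add (S.eig_nonneg (Nat.le_add_left 1 _)) (by positivity)]
    refine ENNReal.ofReal_le_ofReal ?_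
    have h2 := S.antitone (2 ^ (i + 1)) (2 ^ (i + 1) + 1) Nat.one_le_two_pow (by omega)
    have h3 : (2 : ℝ) ^ (-(2 * r)) * S.eig (2 ^ i) ≤ S.eig (2 ^ (i + 1)) := by
      have h4 := hσ (2 ^ i) Nat.one_le_two_pow
      rw [← pow_succ'] at h4
      have h5 := pow_le_pow_left₀ (mul_nonneg (by positivity) (S.sigma_nonneg _)) h4 2
      rw [mul_pow, S.sigma_sq Nat.one_le_two_pow, S.sigma_sq Nat.one_le_two_pow,
        ← Real.rpow_natCast, ← Real.rpow_mul two_pos.le] at h5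
      refine le_of_eq_of_le ?_ h5
      congr 2
      push_cast
      ring
    have h6 : ((2 ^ (i + 1) : ℕ) : ℝ) / ((2 ^ (ell r + (i + 1)) : ℕ) : ℝ) * 2 ≤
        (2 : ℝ) ^ (-(2 * r)) := by
      have h7 : ((2 ^ (i + 1) : ℕ) : ℝ) / ((2 ^ (ell r + (i + 1)) : ℕ) : ℝ) * 2 =
          (2 : ℝ) ^ (1 - (ell r : ℝ)) := by
        rw [Real.rpow_sub two_pos, Real.rpow_one, Real.rpow_natCast]
        push_cast
        rw [pow_add]
        field_simp
        ring
      rw [h7]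
      have h8 : 2 * r + 1 ≤ (ell r : ℝ) := Nat.le_ceil _
      exact Real.rpow_le_rpow_of_exponent_le one_le_two (by linarith)
    have h9 := mul_le_mul_of_nonneg_right h6 he
    nlinarith

/-- The error of the algorithm, compared with the singular value that bounds the minimal error. -/
theorem randError_algorithm_le (hN : S.N = ⊤) {V : Submodule 𝕜 (D → 𝕜)} (hV : IsFunctionSpace T V)
    {r : ℝ} (hr : 0 ≤ r)
    (hσ : ∀ n : ℕ, 1 ≤ n → S.sigma (2 * n) ≥ (2 : ℝ) ^ (-r) * S.sigma n) {Ω : Type uΩ}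
    [MeasurableSpace Ω] (P : Measure Ω) [IsProbabilityMeasure P]
    {X : (j : ℕ) → Fin (nodeCount r j) → Ω → D}
    (hX : S.IsNodes P (nodeCount r) (S.coeffCount r) X) {n : ℕ} (hn : 1 ≤ n) :
    randError T V P (S.algorithm r X n) ≤
      ENNReal.ofReal ((2 : ℝ) ^ (r * (⌈2 * r + 4⌉ : ℤ) + 3 / 2) * (S.sigma (2 * n) / 2)) := by
  have hm := S.monotone_coeffCount hN r
  set k := Nat.log 2 n with hk
  have hnk : n < 2 ^ (k + 1) := Nat.lt_pow_succ_log_self one_lt_two n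
  have hell : ((⌈2 * r + 4⌉ : ℤ) : ℝ) = ((ell r + 3 : ℕ) : ℝ) := by
    have h1 : ((ell r : ℕ) : ℤ) = ⌈2 * r + 1⌉ := Int.natCast_ceil_eq_ceil (by linarith)
    have h2 : ⌈2 * r + 4⌉ = ⌈2 * r + 1⌉ + 3 := by
      rw [show 2 * r + 4 = 2 * r + 1 + (3 : ℤ) by push_cast; ring, Int.ceil_add_intCast]
    rw [h2, ← h1]
    push_cast
    ring
  -- With `2^k ≤ n < 2^(k+1)`, the index is `i = k - ℓ_r - 1`, or `i = 0` if `A_n^r` is zero.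
  have key : ∀ i : ℕ, k + 2 ≤ i + (ell r + 3) → 2 * S.eig (2 ^ i) ≤
      ((2 : ℝ) ^ (r * (⌈2 * r + 4⌉ : ℤ) + 3 / 2) * (S.sigma (2 * n) / 2)) ^ 2 := by
    intro i hi
    have h1 : S.sigma (2 ^ (i + (ell r + 3))) ≤ S.sigma (2 * n) := by
      refine S.sigma_antitone (by omega) ?_
      calc 2 * n ≤ 2 ^ (k + 2) := by rw [pow_succ']; omega
        _ ≤ _ := Nat.pow_le_pow_right (by omega) hi
    have h2 := (S.sigma_pow_le hσ i (ell r + 3)).trans h1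
    have h3 : (2 : ℝ) ^ (1 / 2 : ℝ) * S.sigma (2 ^ i) ≤
        (2 : ℝ) ^ (r * (⌈2 * r + 4⌉ : ℤ) + 3 / 2) * (S.sigma (2 * n) / 2) := by
      rw [hell]
      calc (2 : ℝ) ^ (1 / 2 : ℝ) * S.sigma (2 ^ i)
          = (2 : ℝ) ^ (r * ((ell r + 3 : ℕ) : ℝ) + 3 / 2) *
              ((2 : ℝ) ^ (-(r * ((ell r + 3 : ℕ) : ℝ))) * S.sigma (2 ^ i) / 2) := by
            rw [mul_div_assoc, ← mul_assoc, ← Real.rpow_add two_pos,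
              show r * ((ell r + 3 : ℕ) : ℝ) + 3 / 2 + -(r * ((ell r + 3 : ℕ) : ℝ)) =
                1 / 2 + 1 by ring,
              Real.rpow_add two_pos, Real.rpow_one]
            ring
        _ ≤ _ := by gcongr
    have h4 := pow_le_pow_left₀ (mul_nonneg (by positivity) (S.sigma_nonneg _)) h3 2
    rw [mul_pow, S.sigma_sq Nat.one_le_two_pow, ← Real.rpow_natCast ((2 : ℝ) ^ (1 / 2 : ℝ)),
      ← Real.rpow_mul two_pos.le] at h4
    simpa using h4
  refine iSup₂_le fun f hf => iSup₂_le fun g hg => iSup_le fun hgf => ?_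
  set c := (2 : ℝ) ^ (r * (⌈2 * r + 4⌉ : ℤ) + 3 / 2) * (S.sigma (2 * n) / 2)
  have hE : ∫⁻ ω, ‖T f - S.algorithm r X n ω g‖ₑ ^ 2 ∂P ≤ ENNReal.ofReal (c ^ 2) := by
    simp only [S.algorithm_eq_approx hm]
    rw [← hk]
    rcases le_or_gt k (ell r) with hkl | hkl
    · have h0 : ∀ x, S.approx (nodeCount r) (S.coeffCount r) x k g = 0 := fun x => by
        rw [approx, S.coeffCount_of_top hN, if_pos hkl]
        simp
      simp only [h0, sub_zero, lintegral_const, measure_univ, mul_one]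
      rw [enorm_sq_eq_ofReal]
      refine ENNReal.ofReal_le_ofReal ((S.norm_T_sq_le hN f).trans (le_trans ?_ (key 0 (by omega))))
      have he := S.eig_nonneg le_rfl
      have h1 := mul_le_of_le_one_right he ((sq_le_one_iff₀ (norm_nonneg f)).2 hf)
      rw [pow_zero]
      linarith
    · obtain ⟨i, hi⟩ := Nat.exists_eq_add_of_lt hkl
      rw [hi]
      exact (S.lintegral_algorithm_le hN hσ P hX (hV.measurable g hg) hf hgf i).trans
        (ENNReal.ofReal_le_ofReal (key i (by omega)))
  have hc : 0 ≤ c := mul_nonneg (by positivity) (div_nonneg (S.sigma_nonneg _) two_pos.le)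
  refine (ENNReal.rpow_le_rpow hE (by positivity)).trans (le_of_eq ?_)
  rw [ENNReal.ofReal_pow hc, ← ENNReal.rpow_natCast, ← ENNReal.rpow_mul]
  norm_num

/-- If there are no singular values, then `F` is trivial, and the algorithm has no error. -/
theorem randError_algorithm_of_zero (hN : S.N = 0) {V : Submodule 𝕜 (D → 𝕜)} {r : ℝ} {Ω : Type uΩ}
    [MeasurableSpace Ω] (P : Measure Ω) (X : (j : ℕ) → Fin (nodeCount r j) → Ω → D) (n : ℕ) :
    randError T V P (S.algorithm r X n) = 0 := by
  have hm : Monotone (S.coeffCount r) := fun j k _ => by simp [S.coeffCount_of_zero hN]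
  have hset : {f | ∃ k : ℕ, 1 ≤ k ∧ (k : ℕ∞) ≤ S.N ∧ f = S.b k} = (∅ : Set F) := by
    rw [Set.eq_empty_iff_forall_notMem]
    rintro f ⟨k, hk, hkN, -⟩
    rw [hN] at hkN
    have h1 : k ≤ 0 := by exact_mod_cast hkN
    omega
  have hd := S.dense_span
  rw [hset, Submodule.span_empty] at hd
  have hF : ∀ f : F, f = 0 := fun f => by
    have h1 : f ∈ (⊥ : Submodule 𝕜 F).topologicalClosure := by rw [hd]; trivial
    rw [← SetLike.mem_coe, Submodule.topologicalClosure_coe] at h1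
    simpa using h1
  rw [← nonpos_iff_eq_zero]
  refine iSup₂_le fun f _ => iSup₂_le fun g _ => iSup_le fun _ => ?_
  simp [S.algorithm_eq_approx hm, approx, S.coeffCount_of_zero hN, hF f]

end SVD

end Algorithm

end MCApprox

theorem mainTheorem4
    {D : Type uD} [MeasurableSpace D] {𝕜 : Type uK} [RCLike 𝕜] {μ : Measure D}
    {F : Type uF} [NormedAddCommGroup F] [InnerProductSpace 𝕜 F] [CompleteSpace F]
    (T : F →L[𝕜] Lp 𝕜 2 μ) (hT : Function.Injective T) (hTc : IsCompactOperator T)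
    (V : Submodule 𝕜 (D → 𝕜)) (hV : MCApprox.IsFunctionSpace T V)
    (S : MCApprox.SVD T) (r : ℝ) (hr : 0 ≤ r)
    (hσ : ∀ n : ℕ, 1 ≤ n → S.sigma (2 * n) ≥ (2 : ℝ) ^ (-r) * S.sigma n)
    {Ω : Type uΩ} [MeasurableSpace Ω] (P : Measure Ω) [IsProbabilityMeasure P]
    (X : (j : ℕ) → Fin (MCApprox.SVD.nodeCount r j) → Ω → D)
    (hX : S.IsNodes P (MCApprox.SVD.nodeCount r) (S.coeffCount r) X)
    (n : ℕ) (hn : 1 ≤ n) :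
    MCApprox.IsStdAlgorithm V n (S.algorithm r X n) ∧
      MCApprox.randError T V P (S.algorithm r X n) ≤
        ENNReal.ofReal ((2 : ℝ) ^ (r * (⌈2 * r + 4⌉ : ℤ) + 3 / 2)) *
          MCApprox.minRandError.{uD, uK, uF, uΩ'} T V n := by
  rcases S.N_eq_zero_or_top hσ with hN | hN
  · have hm : Monotone (S.coeffCount r) := fun j k _ => by simp [S.coeffCount_of_zero hN]
    refine ⟨S.isStdAlgorithm hV hm hX.measurable hn, ?_⟩
    rw [S.randError_algorithm_of_zero hN]
    exact zero_le
  · refine ⟨S.isStdAlgorithm hV (S.monotone_coeffCount hN r) hX.measurable hn, ?_⟩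
    refine (S.randError_algorithm_le hN hV hr hσ P hX hn).trans ?_
    rw [ENNReal.ofReal_mul (by positivity)]
    exact mul_le_mul_right (MCApprox.sigma_div_two_le_minRandError hV S hN hn) _
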